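/- Let $m,n\ge 1$. An agenda is a set $\mathbb X\subseteq\{0,1\}^m$ of ("consistent") opinions on $m$ issues. A profile $X=(X_i^j)$ consists of one opinion $X_i\in\{0,1\}^m$ for each of $n$ voters, with $X^j=(X_1^j,\dots,X_n^j)$ the votes on issue $j$; it is consistent if $X\in\mathbb X^n$. A mechanism is a function $F:(\{0,1\}^m)^n\to\{0,1\}^m$. It is consistent if $F(X)\in\mathbb X$ for all $X\in\mathbb X^n$, and independent if for all $X,Y\in\mathbb X^n$ and all $j$, $X^j=Y^j$ implies $F(X)^j=F(Y)^j$. With $X$ and $Y$ uniform on $\mathbb X^n$, put $$d(F,G)=\Pr_X[F(X)\ne G(X)],\qquad IC(F)=\Pr_X[F(X)\notin\mathbb X],$$ $$DI(F)=\max_{1\le j\le m}\ \mathbb E_X\Big[\Pr_Y\big[F(X)^j\ne F(Y)^j \,\big|\, Y^j=X^j\big]\Big].$$ Let $\mathbb X$ be truth-functional with conjunction or xor conclusions: for some set $P\subseteq\{1,\dots,m\}$ of premises, $\mathbb X$ is the set of $x\in\{0,1\}^m$ such that $x^j=\Phi^j\big((x^i)_{i\in P}\big)$ for every $j\notin P$,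 where each $\Phi^j$ is the conjunction or the xor of a nonempty set of premises, possibly with some inputs and the output negated. Let $\epsilon,\delta\in[0,1]$ satisfy $$\delta<n^{-2}\left(\frac{\epsilon}{10m}\right)^{m^2+m-1}.$$ Then no mechanism $F$ on $n$ voters satisfies all three of the following conditions: 1. $F$ is $\delta$-independent; 2. $F$ is $\delta$-consistent; 3. $d(F,G)\ge\epsilon$ for every mechanism $G$ that is both independent and consistent. This holds both when $\delta$-independence and $\delta$-consistency mean $DI(F)\le\delta$ and $IC(F)\le\delta$, and when they mean that there are an independent mechanism $H$ with $d(F,H)\le\delta$ and a consistent mechanism $H'$ with $d(F,H')\le\delta$. -/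

import Mathlib

open scoped Classical

noncomputable section

namespace JudgementAggregation

/-- An opinion on `m` binary issues (`true` is 1, `false` is 0). -/
abbrev Opinion (m : ℕ) : Type := Fin m → Bool

/-- An opinion profile of `n` voters on `m` issues: `X i j` is the vote of voter `i` on issue `j`. -/
abbrev Profile (n m : ℕ) : Type := Fin n → Opinion m

/-- An agenda: the set of consistent opinions. -/
abbrev Agenda (m : ℕ) : Type := Finset (Opinion m)

/-- An aggregation mechanism for `n` voters and `m` issues. -/
abbrev Mechanism (n m : ℕ) : Type := Profile n m → Opinion m

/-- The finite set of consistent profiles: all voters hold consistent opinions. -/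
def consistentProfiles {m : ℕ} (n : ℕ) (A : Agenda m) : Finset (Profile n m) :=
  Fintype.piFinset fun _ : Fin n => A

/-- The probability of `p` under the uniform distribution on the finite set `s`. -/
def uniformProb {α : Type} (s : Finset α) (p : α → Prop) : ℝ :=
  ((s.filter p).card : ℝ) / (s.card : ℝ)

/-- The expectation of `f` under the uniform distribution on the finite set `s`. -/
def uniformMean {α : Type} (s : Finset α) (f : α → ℝ) : ℝ :=
  (∑ a ∈ s, f a) / (s.card : ℝ)

/-- Normalized Hamming distance of two mechanisms on the consistent profiles. -/
def dist {n m : ℕ} (A : Agenda m) (F G : Mechanism n m) : ℝ :=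
  uniformProb (consistentProfiles n A) fun X => F X ≠ G X

/-- A mechanism is consistent if it maps consistent profiles to consistent opinions. -/
def IsConsistent {n m : ℕ} (A : Agenda m) (F : Mechanism n m) : Prop :=
  ∀ X ∈ consistentProfiles n A, F X ∈ A

/-- A mechanism is independent if, on consistent profiles, the aggregated opinion on an issue
depends only on the votes on that issue. -/
def IsIndependent {n m : ℕ} (A : Agenda m) (F : Mechanism n m) : Prop :=
  ∀ X ∈ consistentProfiles n A, ∀ Y ∈ consistentProfiles n A, ∀ j : Fin m,
    (∀ i, X i j = Y i j) → F X j = F Y j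

/-- The inconsistency index: the probability of an inconsistent aggregated opinion. -/
def inconsistencyIndex {n m : ℕ} (A : Agenda m) (F : Mechanism n m) : ℝ :=
  uniformProb (consistentProfiles n A) fun X => F X ∉ A

/-- The dependency index of issue `j`: the mean over a uniform consistent profile `X` of the
probability that `F X` and `F Y` disagree on issue `j`, where `Y` is a uniform consistent profile
conditioned on having the same votes as `X` on issue `j`. -/
def dependencyIndexAt {n m : ℕ} (A : Agenda m) (F : Mechanism n m) (j : Fin m) : ℝ :=
  uniformMean (consistentProfiles n A) fun X =>
    uniformProb ((consistentProfiles n A).filter fun Y => ∀ i, X i j = Y i j)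
      fun Y => F X j ≠ F Y j

/-- The dependency index: the maximum over the issues. -/
def dependencyIndex {n m : ℕ} (A : Agenda m) (F : Mechanism n m) : ℝ :=
  ⨆ j : Fin m, dependencyIndexAt A F j

/-- `F` is within distance `δ` of some consistent mechanism. -/
def IsCloseToConsistent {n m : ℕ} (A : Agenda m) (δ : ℝ) (F : Mechanism n m) : Prop :=
  ∃ H : Mechanism n m, IsConsistent A H ∧ dist A F H ≤ δ

/-- `F` is within distance `δ` of some independent mechanism. -/
def IsCloseToIndependent {n m : ℕ} (A : Agenda m) (δ : ℝ) (F : Mechanism n m) : Prop :=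
  ∃ H : Mechanism n m, IsIndependent A H ∧ dist A F H ≤ δ

/-- `F` is `ε`-far from every mechanism that is both independent and consistent. -/
def IsFarFromIndependentConsistent {n m : ℕ} (A : Agenda m) (ε : ℝ) (F : Mechanism n m) : Prop :=
  ∀ G : Mechanism n m, IsIndependent A G → IsConsistent A G → ε ≤ dist A F G

/-- The agenda `A` is truth-functional with set of premises `P` and conclusion functions `Φ`: an
opinion is consistent iff its value at each issue `j` outside `P` is `Φ j` of its values on `P`. -/
def IsTruthFunctional {m : ℕ} (A : Agenda m) (P : Finset (Fin m))
    (Φ : Fin m → (P → Bool) → Bool) : Prop :=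
  ∀ x : Opinion m, x ∈ A ↔ ∀ j, j ∉ P → x j = Φ j (fun i => x i)

/-- `φ` is a conjunction of some of its inputs, up to negation of the inputs (those `i` with
`σ i = true`) and of the output (if `τ = true`). -/
def IsConjunction {ι : Type} (φ : (ι → Bool) → Bool) : Prop :=
  ∃ (S : Finset ι) (σ : ι → Bool) (τ : Bool), S.Nonempty ∧
    ∀ y, φ y = xor τ (decide (∀ i ∈ S, xor (σ i) (y i) = true))

/-- `φ` is the xor of some of its inputs, up to negation of the inputs (those `i` with
`σ i = true`) and of the output (if `τ = true`). -/
def IsXor {ι : Type} (φ : (ι → Bool) → Bool) : Prop :=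
  ∃ (S : Finset ι) (σ : ι → Bool) (τ : Bool), S.Nonempty ∧
    ∀ y, φ y = xor τ (decide (Odd (S.filter fun i => xor (σ i) (y i) = true).card))

/-- Truth-functional agendas in which every non-premise issue is a conjunction or a xor of
premises, up to negation of inputs or output. -/
def IsConjunctionXorAgenda {m : ℕ} (A : Agenda m) : Prop :=
  ∃ (P : Finset (Fin m)) (Φ : Fin m → (P → Bool) → Bool), IsTruthFunctional A P Φ ∧
    ∀ j, j ∉ P → IsConjunction (Φ j) ∨ IsXor (Φ j)

end JudgementAggregation

end

/-!
Put `θ = ε / (10 m)`. A mechanism that is nearly independent is close to an independent one: on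
each issue, replace the outcome by the more frequent one among the profiles with the same votes on
that issue (`exists_isIndependent_dist_le`). So it suffices to correct an independent mechanism with
small inconsistency index. Such a mechanism is given by functions `f j` of the votes on issue `j`;
the votes on the premises are independent and uniform, and each conclusion says that an equation
`f (φ(x)) = φ(f_i(x_i))` holds for most `x`, with `φ` a conjunction or an exclusive or.

*Conjunctions.* Negating votes and outcomes removes the negations from `φ`. Suppose that no conjunct
is nearly always zero. Flipping a vote of `c` in one argument does not affect the conjunction of the
arguments when `c` votes `0` in another one; so each voter either has small influence on one
conjunct or nearly has a veto on the other (`conj_influence`). Hence all conjuncts have the same set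
`T` of veto players, hardly depend on the voters outside `T`, and are close to the oligarchy of `T`
(`conj_rigidity`). Summing influences over the voters costs a factor `n`, and the bound on a single
influence is a square root; this is where `n ^ 2` comes from.

*Exclusive ors.* Translating two arguments by the same vector preserves the exclusive or, so the
derivatives of the two functions in that direction are independent random bits which nearly always
agree, and therefore nearly constant. The constants form an additive function of the direction, and
every function in the exclusive or is close to a translate of it (`xor_rigidity`).

*Rounding.* A premise function that is `θ`-close to a constant is replaced by that constant; other
premise functions are replaced by the rigid function (oligarchy, dual of an oligarchy, or
nonconstant affine function) very close to them, if there is one. It is unique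
(`IsRigid.eq_of_close`), so the same replacement serves all conclusions in which the premise occurs.
If some conjunct is nearly zero, its rounding is zero and the conclusion is constant, whatever
happens to the other conjuncts. Hence the rounded premise functions are exactly compatible with
every conclusion
(`exists_hasConclusion_of_conclusionError_le`). All premises are rounded at the same scale `θ`, so
the errors add up to less than `ε`.
-/

namespace JudgementAggregation

/-! ### Uniform probabilities -/

theorem uniformProb_eq {α : Type} (s : Finset α) (p : α → Prop) [DecidablePred p] :
    uniformProb s p = ((s.filter p).card : ℝ) / (s.card : ℝ) := by
  unfold uniformProb; congr

theorem uniformProb_nonneg {α : Type} (s : Finset α) (p : α → Prop) : 0 ≤ uniformProb s p := by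
  unfold uniformProb; positivity

theorem uniformProb_mono {α : Type} {s : Finset α} {p q : α → Prop}
    (h : ∀ a ∈ s, p a → q a) : uniformProb s p ≤ uniformProb s q := by
  unfold uniformProb
  gcongr ((?_ : ℕ) : ℝ) / _
  apply Finset.card_le_card
  intro a ha
  rw [Finset.mem_filter] at ha ⊢
  exact ⟨ha.1, h a ha.1 ha.2⟩

theorem uniformProb_congr {α : Type} {s : Finset α} {p q : α → Prop}
    (h : ∀ a ∈ s, (p a ↔ q a)) : uniformProb s p = uniformProb s q :=
  le_antisymm (uniformProb_mono fun a ha => (h a ha).1) (uniformProb_mono fun a ha => (h a ha).2)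

theorem uniformProb_or_le {α : Type} (s : Finset α) (p q : α → Prop) :
    uniformProb s (fun a => p a ∨ q a) ≤ uniformProb s p + uniformProb s q := by
  rw [uniformProb_eq s p, uniformProb_eq s q, uniformProb_eq, ← add_div, Finset.filter_or]
  gcongr
  exact_mod_cast Finset.card_union_le _ _

theorem uniformProb_le_add {α : Type} {s : Finset α} {p q r : α → Prop}
    (h : ∀ a ∈ s, p a → q a ∨ r a) : uniformProb s p ≤ uniformProb s q + uniformProb s r :=
  (uniformProb_mono h).trans (uniformProb_or_le s q r)

theorem uniformProb_false {α : Type} {s : Finset α} {p : α → Prop} (h : ∀ a ∈ s, ¬ p a) :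
    uniformProb s p = 0 := by
  unfold uniformProb
  rw [Finset.filter_false_of_mem h]
  simp

theorem uniformProb_true {α : Type} {s : Finset α} (hs : s.Nonempty) {p : α → Prop}
    (h : ∀ a ∈ s, p a) : uniformProb s p = 1 := by
  unfold uniformProb
  rw [Finset.filter_true_of_mem h]
  have : (s.card : ℝ) ≠ 0 := by exact_mod_cast hs.card_pos.ne'
  exact div_self this

theorem uniformProb_exists_le {α β : Type} (s : Finset α) (t : Finset β) (p : β → α → Prop) :
    uniformProb s (fun a => ∃ b ∈ t, p b a) ≤ ∑ b ∈ t, uniformProb s (p b) := by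
  induction t using Finset.induction_on with
  | empty => simp [uniformProb_false]
  | insert b t hb ih =>
    rw [Finset.sum_insert hb]
    refine (uniformProb_le_add (q := p b) (r := fun a => ∃ b ∈ t, p b a) ?_).trans (by gcongr)
    rintro a - ⟨b', hb', h⟩
    rcases Finset.mem_insert.1 hb' with rfl | hb'
    · exact Or.inl h
    · exact Or.inr ⟨b', hb', h⟩

/-- The probability of `p` for a uniformly random element of a finite type. -/
noncomputable abbrev pr {α : Type} [Fintype α] (p : α → Prop) : ℝ :=
  uniformProb (Finset.univ : Finset α) p

theorem uniformProb_eq_pr {α β : Type} {_ : Fintype β} {s : Finset α} (e : β → α)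
    (he : Set.BijOn e Set.univ (s : Set α)) (p : α → Prop) :
    uniformProb s p = pr fun b => p (e b) := by
  have key : ∀ q : α → Prop, ((Finset.univ : Finset β).filter fun b => q (e b)).card
      = (s.filter q).card := by
    intro q
    refine Finset.card_bij (fun b _ => e b) ?_ ?_ ?_
    · intro b hb
      exact Finset.mem_filter.2 ⟨he.mapsTo (Set.mem_univ b), (Finset.mem_filter.1 hb).2⟩
    · intro b _ b' _ h
      exact he.injOn (Set.mem_univ _) (Set.mem_univ _) h
    · intro a ha
      obtain ⟨b, -, rfl⟩ := he.surjOn (Finset.mem_coe.2 (Finset.mem_filter.1 ha).1)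
      exact ⟨b, Finset.mem_filter.2 ⟨Finset.mem_univ _, (Finset.mem_filter.1 ha).2⟩, rfl⟩
  have h1 := key p
  have h2 := key fun _ => True
  simp only [Finset.filter_true] at h2
  unfold pr uniformProb
  rw [h1, h2]

theorem pr_comp_equiv {α β : Type} [Fintype α] [Fintype β] (e : α ≃ β) (p : β → Prop) :
    pr (fun a => p (e a)) = pr p := by
  refine (uniformProb_eq_pr (s := (Finset.univ : Finset β)) e ?_ p).symm
  simp

theorem pr_not {α : Type} [Fintype α] [Nonempty α] (p : α → Prop) :
    pr (fun a => ¬ p a) = 1 - pr p := by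
  have h : (((Finset.univ : Finset α).filter p).card : ℝ)
      + ((Finset.univ : Finset α).filter fun a => ¬ p a).card = (Finset.univ : Finset α).card := by
    exact_mod_cast Finset.card_filter_add_card_filter_not p
  have h0 : ((Finset.univ : Finset α).card : ℝ) ≠ 0 := by simp
  rw [pr, pr, uniformProb_eq, uniformProb_eq]
  field_simp
  linarith

theorem exists_of_pr_pos {α : Type} [Fintype α] {p : α → Prop} (h : 0 < pr p) : ∃ a, p a := by
  by_contra! hp
  have := uniformProb_false (s := (Finset.univ : Finset α)) fun a _ => hp a
  unfold pr at h
  linarith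

theorem exists_of_pr_not_lt_one {α : Type} [Fintype α] [Nonempty α] {p : α → Prop}
    (h : pr (fun a => ¬ p a) < 1) : ∃ a, p a := by
  refine exists_of_pr_pos (p := p) ?_
  have := pr_not p
  linarith

/-- The coordinates of a uniformly random family are independent. -/
theorem pr_pi {ι : Type} {V : ι → Type} [Fintype ι] [DecidableEq ι] [∀ i, Fintype (V i)]
    (q : ∀ i, V i → Prop) :
    pr (fun x : ∀ i, V i => ∀ i, q i (x i)) = ∏ i, pr (q i) := by
  simp only [pr, uniformProb_eq]
  rw [Finset.prod_div_distrib, Finset.card_univ, Fintype.card_pi]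
  have : (Finset.univ.filter fun x : ∀ i, V i => ∀ i, q i (x i))
      = Fintype.piFinset fun i => Finset.univ.filter (q i) := by
    ext x; simp [Fintype.mem_piFinset]
  rw [this, Fintype.card_piFinset]
  push_cast
  rfl

theorem pr_pi_pair {ι V : Type} [Fintype ι] [Fintype V] [Nonempty V] {i j : ι} (hij : i ≠ j)
    (p q : V → Prop) :
    pr (fun x : ι → V => p (x i) ∧ q (x j)) = pr p * pr q := by
  have h := pr_pi (V := fun _ : ι => V) fun k v => (k = i → p v) ∧ (k = j → q v)
  have h1 : pr (fun x : ι → V => p (x i) ∧ q (x j))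
      = pr (fun x : ι → V => ∀ k, (k = i → p (x k)) ∧ (k = j → q (x k))) := by
    refine uniformProb_congr fun x _ => ⟨?_, fun h => ⟨(h i).1 rfl, (h j).2 rfl⟩⟩
    rintro ⟨h1, h2⟩ k
    exact ⟨by rintro rfl; exact h1, by rintro rfl; exact h2⟩
  rw [h1, h, ← Finset.mul_prod_erase _ _ (Finset.mem_univ i),
    ← Finset.mul_prod_erase _ _ (Finset.mem_erase.2 ⟨hij.symm, Finset.mem_univ j⟩),
    Finset.prod_eq_one, mul_one]
  · congr 1
    · exact uniformProb_congr fun v _ => by simp [hij]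
    · exact uniformProb_congr fun v _ => by simp [hij.symm]
  · intro k hk
    simp only [Finset.mem_erase] at hk
    exact uniformProb_true Finset.univ_nonempty fun v _ => by simp [hk.1, hk.2.1]

theorem pr_pi_single {ι V : Type} [Fintype ι] [Fintype V] [Nonempty V] (i : ι) (p : V → Prop) :
    pr (fun x : ι → V => p (x i)) = pr p := by
  have h := pr_pi (V := fun _ : ι => V) fun k v => (k = i → p v)
  have h1 : pr (fun x : ι → V => p (x i)) = pr (fun x : ι → V => ∀ k, (k = i → p (x k))) := by
    refine uniformProb_congr fun x _ => ⟨?_, fun h => h i rfl⟩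
    rintro h1 k rfl
    exact h1
  rw [h1, h, ← Finset.mul_prod_erase _ _ (Finset.mem_univ i), Finset.prod_eq_one, mul_one]
  · exact uniformProb_congr fun v _ => by simp
  · intro k hk
    simp only [Finset.mem_erase] at hk
    exact uniformProb_true Finset.univ_nonempty fun v _ => by simp [hk.1]

theorem pr_eq_sum {α : Type} [Fintype α] (p : α → Prop) [DecidablePred p] :
    pr p = (∑ a, if p a then (1 : ℝ) else 0) / Fintype.card α := by
  simp [pr, uniformProb_eq]

/-- If `p · v` is unlikely for every `v`, then for some `x` it is unlikely that `p x v`. -/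
theorem exists_pr_le_of_forall {α β : Type} [Fintype α] [Fintype β] [Nonempty α] [Nonempty β]
    {p : α → β → Prop} {η : ℝ} (h : ∀ v, pr (fun x => p x v) ≤ η) :
    ∃ x, pr (fun v => p x v) ≤ η := by
  have hα : (0 : ℝ) < Fintype.card α := by exact_mod_cast Fintype.card_pos
  have hβ : (0 : ℝ) < Fintype.card β := by exact_mod_cast Fintype.card_pos
  have key : ∑ x, ∑ v, (if p x v then (1 : ℝ) else 0) ≤ ∑ _x : α, η * Fintype.card β := by
    rw [Finset.sum_comm]
    calc ∑ v, ∑ x, (if p x v then (1 : ℝ) else 0) ≤ ∑ _v : β, η * Fintype.card α := by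
          refine Finset.sum_le_sum fun v _ => ?_
          have := h v
          rwa [pr_eq_sum, div_le_iff₀ hα] at this
      _ = _ := by simp; ring
  obtain ⟨x, -, hx⟩ := Finset.exists_le_of_sum_le Finset.univ_nonempty key
  refine ⟨x, ?_⟩
  rwa [pr_eq_sum, div_le_iff₀ hβ]

/-! ### Vote vectors -/

/-- The votes of `n` voters on a single issue. -/
abbrev Votes (n : ℕ) : Type := Fin n → Bool

/-- The translate of `x` by `v` in the group `{0,1}^n`. -/
def shift {n : ℕ} (v x : Votes n) : Votes n := fun c => xor (x c) (v c)

/-- The indicator vector of a set of voters. -/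
def indicator {n : ℕ} (U : Finset (Fin n)) : Votes n := fun c => decide (c ∈ U)

theorem shift_apply {n : ℕ} (v x : Votes n) (c : Fin n) : shift v x c = xor (x c) (v c) := rfl

theorem shift_shift {n : ℕ} (v x : Votes n) : shift v (shift v x) = x := by
  funext c; simp [shift]

theorem shift_comm {n : ℕ} (v x : Votes n) : shift v x = shift x v := by
  funext c; simp [shift, Bool.xor_comm]

theorem pr_shift {n : ℕ} (v : Votes n) (p : Votes n → Prop) :
    pr (fun x => p (shift v x)) = pr p :=
  pr_comp_equiv (Function.Involutive.toPerm (shift v) (shift_shift v)) p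

/-- Any two points differ by a unique translation, so independent events that are rarely related by
any single translation cannot both be likely. -/
theorem pr_mul_pr_le_of_shift {n : ℕ} {p q : Votes n → Prop} {η : ℝ}
    (h : ∀ v, pr (fun x => p x ∧ q (shift v x)) ≤ η) : pr p * pr q ≤ η := by
  have h0 : (0 : ℝ) < Fintype.card (Votes n) := by exact_mod_cast Fintype.card_pos
  have hq : ∀ x, ∑ v, (if q (shift v x) then (1 : ℝ) else 0) = pr q * Fintype.card (Votes n) := by
    intro x
    have := pr_shift x q
    rw [pr_eq_sum, div_eq_iff h0.ne'] at this
    rw [← this]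
    exact Finset.sum_congr rfl fun v _ => by rw [shift_comm]
  have key : ∑ x : Votes n, (if p x then (1 : ℝ) else 0) * (pr q * Fintype.card (Votes n))
      ≤ ∑ _v : Votes n, η * Fintype.card (Votes n) := by
    calc ∑ x : Votes n, (if p x then (1 : ℝ) else 0) * (pr q * Fintype.card (Votes n))
        = ∑ x : Votes n, ∑ v : Votes n, (if p x ∧ q (shift v x) then (1 : ℝ) else 0) := by
          refine Finset.sum_congr rfl fun x _ => ?_
          rw [← hq x, Finset.mul_sum]
          refine Finset.sum_congr rfl fun v _ => ?_
          by_cases h1 : p x <;> by_cases h2 : q (shift v x) <;> simp [h1, h2]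
      _ = ∑ v : Votes n, ∑ x : Votes n, (if p x ∧ q (shift v x) then (1 : ℝ) else 0) :=
          Finset.sum_comm
      _ ≤ _ := by
          refine Finset.sum_le_sum fun v _ => ?_
          have := h v
          rwa [pr_eq_sum, div_le_iff₀ h0] at this
  rw [← Finset.sum_mul, Finset.sum_const, nsmul_eq_mul, Finset.card_univ] at key
  rw [pr_eq_sum p, div_mul_eq_mul_div, div_le_iff₀ h0]
  nlinarith

/-- A function moves under a translation at most as much as under the single flips composing it. -/
theorem pr_ne_shift_indicator_le {n : ℕ} (g : Votes n → Bool) (U : Finset (Fin n)) :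
    pr (fun x => g x ≠ g (shift (indicator U) x))
      ≤ ∑ c ∈ U, pr (fun x => g x ≠ g (shift (indicator {c}) x)) := by
  induction U using Finset.induction_on with
  | empty =>
    have : shift (indicator (∅ : Finset (Fin n))) = id := by
      funext x c; simp [shift, indicator]
    simp [this, uniformProb_false]
  | insert c U hc ih =>
    rw [Finset.sum_insert hc, add_comm]
    have hs : ∀ x : Votes n, shift (indicator (insert c U)) x
        = shift (indicator {c}) (shift (indicator U) x) := by
      intro x; funext d
      by_cases hd : d = c
      · subst hd; simp [shift, indicator, hc]
      · simp [shift, indicator, hd]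
    refine (uniformProb_le_add (q := fun x => g x ≠ g (shift (indicator U) x))
      (r := fun x => g (shift (indicator U) x)
        ≠ g (shift (indicator {c}) (shift (indicator U) x))) ?_).trans ?_
    · intro x _ h
      rw [hs] at h
      by_contra! h'
      exact h (h'.1.trans h'.2)
    · exact add_le_add ih
        (pr_shift (indicator U) fun x => g x ≠ g (shift (indicator {c}) x)).le

/-- The conjunction of the votes of the voters in `T`: the oligarchy of `T`. -/
def oligarchy {n : ℕ} (T : Finset (Fin n)) (x : Votes n) : Bool := decide (∀ c ∈ T, x c = true)

theorem oligarchy_eq_true {n : ℕ} {T : Finset (Fin n)} {x : Votes n} :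
    oligarchy T x = true ↔ ∀ c ∈ T, x c = true := by simp [oligarchy]

theorem pr_oligarchy {n : ℕ} (T : Finset (Fin n)) :
    pr (fun x => oligarchy T x = true) = (1 / 2 : ℝ) ^ T.card := by
  have h := pr_pi (V := fun _ : Fin n => Bool) fun c b => (c ∈ T → b = true)
  have hb : ∀ c, pr (fun b : Bool => (c ∈ T → b = true)) = if c ∈ T then (1 / 2 : ℝ) else 1 := by
    intro c
    rw [pr_eq_sum]
    by_cases hc : c ∈ T <;> simp [hc]
  rw [Finset.prod_congr rfl fun c _ => hb c, Finset.prod_ite] at h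
  simp only [oligarchy_eq_true]
  rw [show pr (fun x : Votes n => ∀ c ∈ T, x c = true) = _ from h]
  simp

/-! ### Approximate conjunctions -/

/-- Flipping the vote of `c` in the `i`-th argument does not change the conjunction of the arguments
if `c` votes `0` in the `j`-th one. Hence either `c` has small influence on `g i`, or `c` votes `1`
almost whenever `g j` is `1`. -/
theorem conj_influence {ι : Type} [Fintype ι] {n : ℕ} {S : Finset ι} {f : Votes n → Bool}
    {g : ι → Votes n → Bool} {η θ : ℝ} (hθ0 : 0 ≤ θ) (hθ1 : θ ≤ 1)
    (hη : pr (fun x : ι → Votes n => f (fun c => decide (∀ i ∈ S, x i c = true))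
      ≠ decide (∀ i ∈ S, g i (x i) = true)) ≤ η)
    (hg : ∀ i ∈ S, θ ≤ pr (fun x => g i x = true)) {i j : ι} (hi : i ∈ S) (hj : j ∈ S)
    (hij : i ≠ j) (c : Fin n) :
    pr (fun x => g i x ≠ g i (shift (indicator {c}) x))
      * pr (fun x => g j x = true ∧ x c = false) * θ ^ Fintype.card ι ≤ 2 * η := by
  set flip : Votes n → Votes n := shift (indicator {c}) with hflip
  set Q : ι → Votes n → Prop := fun k x => (k = i → g i x ≠ g i (flip x)) ∧
    (k = j → g j x = true ∧ x c = false) ∧ (k ∈ S → k ≠ i → g k x = true) with hQ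
  set a := pr (fun x => g i x ≠ g i (flip x)) with ha
  set b := pr (fun x => g j x = true ∧ x c = false) with hb
  have ha0 : 0 ≤ a := uniformProb_nonneg _ _
  have hb0 : 0 ≤ b := uniformProb_nonneg _ _
  have hlow : a * b * θ ^ Fintype.card ι ≤ pr (fun x : ι → Votes n => ∀ k, Q k (x k)) := by
    rw [pr_pi (V := fun _ : ι => Votes n) Q, ← Finset.mul_prod_erase _ _ (Finset.mem_univ i),
      ← Finset.mul_prod_erase _ _ (Finset.mem_erase.2 ⟨hij.symm, Finset.mem_univ j⟩), ← mul_assoc]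
    have h1 : pr (Q i) = a := uniformProb_congr fun x _ => by simp [hQ, hij]
    have h2 : pr (Q j) = b := uniformProb_congr fun x _ => by
      simp only [hQ, hij.symm, false_imp_iff, true_and, true_imp_iff]
      exact ⟨fun h => h.1, fun h => ⟨h, fun _ _ => h.1⟩⟩
    rw [h1, h2]
    gcongr
    calc θ ^ Fintype.card ι ≤ θ ^ ((Finset.univ.erase i).erase j).card :=
          pow_le_pow_of_le_one hθ0 hθ1 (Finset.card_le_univ _)
      _ = ∏ _k ∈ (Finset.univ.erase i).erase j, θ := by simp
      _ ≤ _ := by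
          refine Finset.prod_le_prod (fun _ _ => hθ0) fun k hk => ?_
          simp only [Finset.mem_erase] at hk
          by_cases hkS : k ∈ S
          · refine (hg k hkS).trans (uniformProb_mono fun x _ h => ?_)
            simp [hQ, hk.1, hk.2.1, h]
          · refine hθ1.trans (uniformProb_true Finset.univ_nonempty fun x _ => ?_).ge
            simp [hQ, hk.1, hk.2.1, hkS]
  -- at each point of the event, the test fails there or at the point with that vote flipped
  set bad : (ι → Votes n) → Prop := fun x => f (fun c => decide (∀ i ∈ S, x i c = true))
      ≠ decide (∀ i ∈ S, g i (x i) = true) with hbad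
  set e : (ι → Votes n) → (ι → Votes n) := fun x => Function.update x i (flip (x i)) with he
  have hinv : Function.Involutive e := by
    intro x; simp [he, hflip, shift_shift]
  have hup : pr (fun x : ι → Votes n => ∀ k, Q k (x k)) ≤ pr bad + pr (fun x => bad (e x)) := by
    refine uniformProb_le_add fun x _ hx => ?_
    by_contra! hcon
    obtain ⟨h1, h2⟩ := hcon
    simp only [hbad, not_not] at h1 h2
    obtain ⟨hgj, hxj⟩ := (hx j).2.1 rfl
    have hsame : (fun d => decide (∀ k ∈ S, e x k d = true))
        = fun d => decide (∀ k ∈ S, x k d = true) := by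
      funext d
      by_cases hd : d = c
      · subst hd
        have l1 : ¬ ∀ k ∈ S, e x k d = true := fun h => by
          have := h j hj
          simp [he, hij.symm, hxj] at this
        have l2 : ¬ ∀ k ∈ S, x k d = true := fun h => by
          have := h j hj
          simp [hxj] at this
        simp only [l1, l2]
      · congr 1
        refine propext (forall₂_congr fun k _ => ?_)
        by_cases hk : k = i
        · subst hk; simp [he, hflip, shift, indicator, hd]
        · simp [he, hk]
    rw [hsame, h1] at h2
    have hall : ∀ y : ι → Votes n, (∀ k, k ≠ i → y k = x k) →
        (decide (∀ k ∈ S, g k (y k) = true) = g i (y i)) := by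
      intro y hy
      rw [Bool.eq_iff_iff, decide_eq_true_iff]
      refine ⟨fun h => h i hi, fun h k hk => ?_⟩
      by_cases hki : k = i
      · subst hki; exact h
      · rw [hy k hki]; exact (hx k).2.2 hk hki
    rw [hall x fun _ _ => rfl, hall (e x) fun k hk => by simp [he, hk]] at h2
    have h3 := (hx i).1 rfl
    simp [he] at h2
    exact h3 h2
  have hpe : pr (fun x => bad (e x)) = pr bad := pr_comp_equiv hinv.toPerm bad
  linarith

/-- A function of measure at least `θ` that has small influences outside `T`, and that is mostly
zero where a voter of `T` votes `0`, is close to the oligarchy of `T`. -/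
theorem pr_ne_oligarchy_le {n : ℕ} {g : Votes n → Bool} {T : Finset (Fin n)} {θ β : ℝ}
    (hθ0 : 0 < θ) (hθ1 : θ ≤ 1 / 10) (hβ : β ≤ θ ^ 2 / 20)
    (hg : θ ≤ pr (fun x => g x = true))
    (hT : ∑ c ∈ T, pr (fun x => g x = true ∧ x c = false) ≤ β)
    (hI : ∑ c ∈ Tᶜ, pr (fun x => g x ≠ g (shift (indicator {c}) x)) ≤ β) :
    pr (fun x => g x ≠ oligarchy T x) ≤ θ / 10 := by
  have h1 : pr (fun x => g x = true ∧ oligarchy T x = false) ≤ β := by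
    refine le_trans ?_ ((uniformProb_exists_le _ T _).trans hT)
    refine uniformProb_mono fun x _ hx => ?_
    have : ¬ ∀ c ∈ T, x c = true := by
      rw [← oligarchy_eq_true]; simp [hx.2]
    push Not at this
    obtain ⟨c, hc, hxc⟩ := this
    exact ⟨c, hc, hx.1, by simpa using hxc⟩
  have h2 : θ ≤ pr (fun x => g x = true ∧ oligarchy T x = true) + β := by
    refine hg.trans (le_trans ?_ (add_le_add le_rfl h1))
    refine uniformProb_le_add fun x _ hx => ?_
    cases h : oligarchy T x <;> simp [hx]
  have h3 : pr (fun x => g x = false ∧ oligarchy T x = true)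
      * pr (fun x => g x = true ∧ oligarchy T x = true) ≤ β := by
    refine pr_mul_pr_le_of_shift fun v => ?_
    -- two points where all of `T` votes `1` differ by a translation supported outside `T`
    by_cases hv : ∀ c ∈ T, v c = false
    · set U := Finset.univ.filter fun c => v c = true with hU
      have hvU : v = indicator U := by
        funext c; simp [indicator, hU]
      have hUT : U ⊆ Tᶜ := by
        intro c hc
        rw [Finset.mem_compl]
        intro hcT
        simp [hU, hv c hcT] at hc
      calc _ ≤ pr (fun x => g x ≠ g (shift (indicator U) x)) := by
            refine uniformProb_mono fun x _ hx => ?_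
            rw [← hvU, hx.1.1, hx.2.1]; simp
        _ ≤ _ := pr_ne_shift_indicator_le g U
        _ ≤ _ := Finset.sum_le_sum_of_subset_of_nonneg hUT fun _ _ _ => uniformProb_nonneg _ _
        _ ≤ β := hI
    · refine (uniformProb_false fun x _ hx => hv fun c hc => ?_).le.trans
        ((uniformProb_nonneg _ _).trans h1)
      have e1 := oligarchy_eq_true.1 hx.1.2 c hc
      have e2 := oligarchy_eq_true.1 hx.2.2 c hc
      simpa [shift, e1] using e2
  have h4 : pr (fun x => g x ≠ oligarchy T x)
      ≤ pr (fun x => g x = true ∧ oligarchy T x = false)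
        + pr (fun x => g x = false ∧ oligarchy T x = true) := by
    refine uniformProb_le_add fun x _ hx => ?_
    cases h : oligarchy T x <;> cases h' : g x <;> simp_all
  set u := pr (fun x => g x = false ∧ oligarchy T x = true)
  set w := pr (fun x => g x = true ∧ oligarchy T x = true)
  have hu : 0 ≤ u := uniformProb_nonneg _ _
  have h5 : u ≤ θ / 19 := by
    by_contra! hcon
    have : θ / 19 * (θ - θ ^ 2 / 20) ≤ u * w := by
      apply mul_le_mul hcon.le _ _ hu <;> nlinarith
    nlinarith [pow_pos hθ0 2, pow_pos hθ0 3]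
  nlinarith

/-- If a conjunction of at least two functions of measure at least `θ` is, up to a small error, a
function of the conjunction of the arguments, then all of them are close to one oligarchy. -/
theorem conj_rigidity {ι : Type} [Fintype ι] {n : ℕ} (hn : 1 ≤ n) {S : Finset ι}
    {f : Votes n → Bool} {g : ι → Votes n → Bool} {η θ : ℝ} (hθ0 : 0 < θ) (hθ1 : θ ≤ 1 / 10)
    (hηθ : 800 * (n : ℝ) ^ 2 * η ≤ θ ^ (Fintype.card ι + 4))
    (hη : pr (fun x : ι → Votes n => f (fun c => decide (∀ i ∈ S, x i c = true))
      ≠ decide (∀ i ∈ S, g i (x i) = true)) ≤ η)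
    (hg : ∀ i ∈ S, θ ≤ pr (fun x => g i x = true)) (hS : 2 ≤ S.card) :
    ∃ T : Finset (Fin n), ∀ i ∈ S, pr (fun x => g i x ≠ oligarchy T x) ≤ θ / 10 := by
  have hn' : (1 : ℝ) ≤ n := by exact_mod_cast hn
  -- this threshold lets errors add up to only `θ ^ 2 / 20` over all voters
  set τ : ℝ := θ ^ 2 / (20 * n) with hτ
  have hτ0 : 0 < τ := by positivity
  have hnτ : n * τ = θ ^ 2 / 20 := by rw [hτ]; field_simp
  have hτθ : τ ≤ θ ^ 2 / 20 := by rw [← hnτ]; nlinarith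
  -- `Z i` consists of the voters with a near veto on `g i`
  set Z : ι → Finset (Fin n) := fun i =>
    Finset.univ.filter fun c => pr (fun x => g i x = true ∧ x c = false) ≤ τ with hZ
  have hinf : ∀ i ∈ S, ∀ j ∈ S, i ≠ j → ∀ c, c ∉ Z j →
      pr (fun x => g i x ≠ g i (shift (indicator {c}) x)) ≤ τ := by
    intro i hi j hj hij c hc
    have hc' : τ < pr (fun x => g j x = true ∧ x c = false) := by simpa [hZ] using hc
    have h := conj_influence hθ0.le (by linarith) hη hg hi hj hij c
    by_contra! hcon
    have hp : (0 : ℝ) < θ ^ Fintype.card ι := by positivity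
    have h1 : τ * τ < pr (fun x => g i x ≠ g i (shift (indicator {c}) x))
        * pr (fun x => g j x = true ∧ x c = false) :=
      mul_lt_mul'' hcon hc' hτ0.le hτ0.le
    have h2 : 2 * η ≤ τ * τ * θ ^ Fintype.card ι := by
      have : τ * τ * θ ^ Fintype.card ι = θ ^ (Fintype.card ι + 4) / (400 * (n : ℝ) ^ 2) := by
        rw [hτ]; field_simp; ring
      rw [this, le_div_iff₀ (by positivity)]
      linarith
    nlinarith [mul_lt_mul_of_pos_right h1 hp]
  -- a voter with a near veto on `g i` and small influence on it would make `g i` nearly zero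
  have hsub : ∀ i ∈ S, ∀ j ∈ S, i ≠ j → Z i ⊆ Z j := by
    intro i hi j hj hij c hc
    by_contra hcj
    have hc' : pr (fun x => g i x = true ∧ x c = false) ≤ τ := by simpa [hZ] using hc
    have h1 := hinf i hi j hj hij c hcj
    have h2 := pr_shift (indicator {c}) fun x => g i x = true ∧ x c = false
    have h3 : pr (fun x => g i x = true)
        ≤ pr (fun x => g i x = true ∧ x c = false)
          + pr (fun x => g i x ≠ g i (shift (indicator {c}) x)
            ∨ (g i (shift (indicator {c}) x) = true ∧ shift (indicator {c}) x c = false)) := by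
      refine uniformProb_le_add fun x _ hx => ?_
      cases h : x c
      · simp [hx]
      · right
        have : shift (indicator {c}) x c = false := by simp [shift, indicator, h]
        rw [this, hx]
        cases g i (shift (indicator {c}) x) <;> simp
    have h4 := uniformProb_or_le (Finset.univ : Finset (Votes n))
      (fun x => g i x ≠ g i (shift (indicator {c}) x))
      (fun x => g i (shift (indicator {c}) x) = true ∧ shift (indicator {c}) x c = false)
    have h5 := hg i hi
    simp only [pr] at *
    nlinarith
  obtain ⟨i₀, hi₀⟩ : S.Nonempty := Finset.card_pos.1 (by omega)
  refine ⟨Z i₀, fun i hi => ?_⟩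
  have hZeq : Z i₀ = Z i := by
    by_cases h : i = i₀
    · rw [h]
    · exact (hsub _ hi₀ _ hi (Ne.symm h)).antisymm (hsub _ hi _ hi₀ h)
  obtain ⟨j, hj, hji⟩ := Finset.exists_mem_ne (by omega : 1 < S.card) i
  have hZj : Z i = Z j := (hsub _ hi _ hj hji.symm).antisymm (hsub _ hj _ hi hji)
  rw [hZeq]
  have hcard : ∀ U : Finset (Fin n), (U.card : ℝ) * τ ≤ n * τ := by
    intro U
    gcongr
    simpa using Finset.card_le_univ U
  refine pr_ne_oligarchy_le hθ0 hθ1 hnτ.le (hg i hi) ?_ ?_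
  · refine (Finset.sum_le_sum fun c hc => ?_).trans
      ((Finset.sum_const (s := Z i) τ).trans_le (by simpa using hcard (Z i)))
    simpa [hZ] using hc
  · refine (Finset.sum_le_sum fun c hc => ?_).trans
      ((Finset.sum_const (s := (Z i)ᶜ) τ).trans_le (by simpa only [nsmul_eq_mul] using hcard _))
    rw [Finset.mem_compl, hZj] at hc
    exact hinf i hi j hj hji.symm c hc

/-! ### Approximate exclusive ors -/

/-- `f` is a homomorphism from the group `{0,1}^n` to `{0,1}`. -/
def IsAdditive {n : ℕ} (f : Votes n → Bool) : Prop :=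
  ∀ u v, f (shift u v) = xor (f u) (f v)

/-- The derivative of `f` in direction `v`. -/
def derivative {n : ℕ} (f : Votes n → Bool) (v x : Votes n) : Bool :=
  xor (f (shift v x)) (f x)

/-- Two independent random bits that are almost always equal are almost constant. -/
theorem exists_pr_ne_le_of_pr_ne_le {ι V : Type} [Fintype ι] [Fintype V] [Nonempty V] {i j : ι}
    (hij : i ≠ j) {p q : V → Bool} {η : ℝ} (hη' : 8 * η ≤ 1)
    (h : pr (fun x : ι → V => p (x i) ≠ q (x j)) ≤ 2 * η) :
    ∃ b : Bool, pr (fun x => p x ≠ b) ≤ 4 * η ∧ pr (fun x => q x ≠ b) ≤ 4 * η := by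
  have hη : 0 ≤ 2 * η := (uniformProb_nonneg _ _).trans h
  have hmul : ∀ b : Bool, pr (fun x => p x = b) * pr (fun x => q x ≠ b) ≤ 2 * η := by
    intro b
    rw [← pr_pi_pair hij (fun x => p x = b) fun x => q x ≠ b]
    refine (uniformProb_mono fun x _ hx => ?_).trans h
    rw [hx.1]; exact hx.2.symm
  have hmul' : ∀ b : Bool, pr (fun x => p x ≠ b) * pr (fun x => q x = b) ≤ 2 * η := by
    intro b
    rw [← pr_pi_pair hij (fun x => p x ≠ b) fun x => q x = b]
    refine (uniformProb_mono fun x _ hx => ?_).trans h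
    rw [hx.2]; exact hx.1
  have key : ∀ b : Bool, 1 / 2 ≤ pr (fun x => p x = b) →
      pr (fun x => p x ≠ b) ≤ 4 * η ∧ pr (fun x => q x ≠ b) ≤ 4 * η := by
    intro b hb
    have h1 := hmul b
    have h2 := hmul' b
    have hp := pr_not fun x => p x = b
    have hq := pr_not fun x => q x = b
    have h3 : 0 ≤ pr (fun x => q x ≠ b) := uniformProb_nonneg _ _
    have h4 : 0 ≤ pr (fun x => p x ≠ b) := uniformProb_nonneg _ _
    have h5 : pr (fun x => q x ≠ b) ≤ 4 * η := by nlinarith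
    refine ⟨?_, h5⟩
    have h6 : 1 / 2 ≤ pr (fun x => q x = b) := by
      simp only [ne_eq] at *
      linarith
    nlinarith
  by_cases hb : 1 / 2 ≤ pr (fun x => p x = true)
  · exact ⟨true, key true hb⟩
  · refine ⟨false, key false ?_⟩
    have := pr_not fun x => p x = true
    simp only [Bool.not_eq_true] at this
    linarith [not_le.1 hb]

/-- If an exclusive or of at least two functions is, up to a small error, a function of the
exclusive or of the arguments, then all of them are close to translates of one additive function.
The hypotheses on `φ` express that it is the exclusive or of the inputs in `S` up to a constant. -/
theorem xor_rigidity {ι : Type} [Fintype ι] {n : ℕ} {S : Finset ι}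
    {φ : (ι → Bool) → Bool}
    (hφ : ∀ i ∈ S, ∀ y a, φ (Function.update y i (xor (y i) a)) = xor (φ y) a)
    {f : Votes n → Bool} {g : ι → Votes n → Bool} {η : ℝ} (hη1 : 12 * η < 1)
    (hη : pr (fun x : ι → Votes n => f (fun c => φ fun i => x i c) ≠ φ fun i => g i (x i)) ≤ η)
    (hS : 2 ≤ S.card) :
    ∃ χ : Votes n → Bool, IsAdditive χ ∧
      ∀ i ∈ S, ∃ b : Bool, pr (fun x => g i x ≠ xor b (χ x)) ≤ 4 * η := by
  have hη0 : 0 ≤ η := (uniformProb_nonneg _ _).trans hη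
  have hpair : ∀ i ∈ S, ∀ j ∈ S, i ≠ j → ∀ v, ∃ b : Bool,
      pr (fun x => derivative (g i) v x ≠ b) ≤ 4 * η ∧
      pr (fun x => derivative (g j) v x ≠ b) ≤ 4 * η := by
    intro i hi j hj hij v
    refine exists_pr_ne_le_of_pr_ne_le hij (by linarith) ?_
    set bad : (ι → Votes n) → Prop :=
      fun x => f (fun c => φ fun i => x i c) ≠ φ fun i => g i (x i) with hbad
    -- translating both the `i`-th and the `j`-th argument by `v` preserves the exclusive or
    set e : (ι → Votes n) → (ι → Votes n) := fun x k =>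
      if k = i ∨ k = j then shift v (x k) else x k with he
    have hinv : Function.Involutive e := by
      intro x; funext k
      by_cases hk : k = i ∨ k = j
      · simp only [he, hk, if_true, shift_shift]
      · simp only [he, hk, if_false]
    have hupd : ∀ y z : ι → Bool, (∀ k, k ≠ i → k ≠ j → z k = y k) →
        φ z = xor (xor (φ y) (xor (z i) (y i))) (xor (z j) (y j)) := by
      intro y z hz
      rw [← hφ i hi y, ← hφ j hj]
      congr 1
      funext k
      by_cases hkj : k = j
      · subst hkj
        simp only [Function.update_self, Function.update_of_ne hij.symm]
        cases y k <;> cases z k <;> rfl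
      · by_cases hki : k = i
        · subst hki
          simp only [Function.update_self, Function.update_of_ne hij]
          cases y k <;> cases z k <;> rfl
        · simp [hki, hkj, hz]
    have hpe : pr (fun x => bad (e x)) = pr bad := pr_comp_equiv hinv.toPerm bad
    calc _ ≤ pr bad + pr (fun x => bad (e x)) := by
          refine uniformProb_le_add fun x _ hx => ?_
          by_contra! hcon
          obtain ⟨h1, h2⟩ := hcon
          simp only [hbad, not_not] at h1 h2
          have hsame : (fun c => φ fun k => e x k c) = fun c => φ fun k => x k c := by
            funext c
            rw [hupd (fun k => x k c) (fun k => e x k c) fun k hki hkj => by simp [he, hki, hkj]]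
            simp [he, shift]
            generalize φ _ = a
            cases a <;> cases x i c <;> cases x j c <;> cases v c <;> rfl
          rw [hsame, h1, hupd (fun k => g k (x k)) (fun k => g k (e x k))
            fun k hki hkj => by simp [he, hki, hkj]] at h2
          refine hx ?_
          simp only [he, true_or, or_true, if_true] at h2
          unfold derivative
          revert h2
          generalize (φ _) = a
          cases a <;> cases g i (x i) <;> cases g j (x j) <;> cases g i (shift v (x i)) <;>
            cases g j (shift v (x j)) <;> simp
      _ ≤ 2 * η := by linarith
  obtain ⟨i₀, hi₀⟩ : S.Nonempty := Finset.card_pos.1 (by omega)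
  have hχ : ∀ v, ∃ b : Bool, pr (fun x => derivative (g i₀) v x ≠ b) ≤ 4 * η := by
    intro v
    obtain ⟨j, hj, hji⟩ := Finset.exists_mem_ne (by omega : 1 < S.card) i₀
    obtain ⟨b, hb, -⟩ := hpair i₀ hi₀ j hj hji.symm v
    exact ⟨b, hb⟩
  choose χ hχ using hχ
  have hall : ∀ i ∈ S, ∀ v, pr (fun x => derivative (g i) v x ≠ χ v) ≤ 4 * η := by
    intro i hi v
    by_cases h : i = i₀
    · rw [h]; exact hχ v
    · obtain ⟨b, hb, hb'⟩ := hpair i hi i₀ hi₀ h v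
      have : b = χ v := by
        by_contra hne
        obtain ⟨x, hx⟩ := exists_of_pr_not_lt_one
          (p := fun x => derivative (g i₀) v x = b ∧ derivative (g i₀) v x = χ v) <| by
          refine (uniformProb_le_add (q := fun x => derivative (g i₀) v x ≠ b)
            (r := fun x => derivative (g i₀) v x ≠ χ v) fun x _ hx => ?_).trans_lt
            ((add_le_add hb' (hχ v)).trans_lt (by linarith))
          by_contra! h'
          exact hx h'
        exact hne (hx.1.symm.trans hx.2)
      rwa [this] at hb
  have hadd : IsAdditive χ := by
    intro u v
    -- the cocycle identity of the derivative holds at every point, so at a good one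
    have hv' : pr (fun x => derivative (g i₀) v (shift u x) ≠ χ v) ≤ 4 * η := by
      have := pr_shift u fun x => derivative (g i₀) v x ≠ χ v
      rw [this]
      exact hχ v
    obtain ⟨x, hx⟩ := exists_of_pr_not_lt_one
      (p := fun x => derivative (g i₀) (shift u v) x = χ (shift u v) ∧
        derivative (g i₀) u x = χ u ∧ derivative (g i₀) v (shift u x) = χ v) <| by
      refine (uniformProb_le_add (q := fun x => derivative (g i₀) (shift u v) x ≠ χ (shift u v))
        (r := fun x => derivative (g i₀) u x ≠ χ u ∨ derivative (g i₀) v (shift u x) ≠ χ v)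
        fun x _ hx => ?_).trans_lt ((add_le_add (hχ (shift u v))
          ((uniformProb_or_le _ _ _).trans (add_le_add (hχ u) hv'))).trans_lt (by linarith))
      by_contra! h'
      exact hx h'
    obtain ⟨h1, h2, h3⟩ := hx
    have hs : shift (shift u v) x = shift v (shift u x) := by
      funext c; simp [shift, Bool.xor_comm, Bool.xor_left_comm]
    rw [← h1, ← h2, ← h3]
    unfold derivative
    rw [hs]
    cases g i₀ (shift v (shift u x)) <;> cases g i₀ (shift u x) <;> cases g i₀ x <;> rfl
  refine ⟨χ, hadd, fun i hi => ?_⟩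
  obtain ⟨x, hx⟩ := exists_pr_le_of_forall (hall i hi)
  refine ⟨xor (g i x) (χ x), ?_⟩
  rw [← pr_shift x]
  refine (uniformProb_mono fun v _ hv => ?_).trans hx
  rw [hadd x v] at hv
  unfold derivative
  rw [shift_comm]
  revert hv
  cases g i (shift x v) <;> cases g i x <;> cases χ x <;> cases χ v <;> simp

/-! ### Rigid functions and rounding -/

theorem IsAdditive.pr_eq_true {n : ℕ} {χ : Votes n → Bool} (h : IsAdditive χ) {v : Votes n}
    (hv : χ v = true) (b : Bool) : pr (fun x => χ x = b) = 1 / 2 := by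
  have h1 := pr_shift v fun x => χ x = b
  have h2 := pr_not fun x => χ x = b
  have h3 : pr (fun x => χ (shift v x) = b) = pr (fun x => ¬ χ x = b) := by
    refine uniformProb_congr fun x _ => ?_
    rw [h, hv]
    cases χ x <;> cases b <;> simp
  linarith

theorem IsAdditive.add {n : ℕ} {χ ψ : Votes n → Bool} (hχ : IsAdditive χ) (hψ : IsAdditive ψ) :
    IsAdditive fun x => xor (χ x) (ψ x) := by
  intro u v
  simp only [hχ u v, hψ u v]
  cases χ u <;> cases χ v <;> cases ψ u <;> cases ψ v <;> rfl

/-- Conjugation by negation of the input and the output if `σ = true`. -/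
def twist {n : ℕ} (σ : Bool) (f : Votes n → Bool) : Votes n → Bool :=
  fun x => xor σ (f (fun c => xor σ (x c)))

theorem twist_twist {n : ℕ} (σ : Bool) (f : Votes n → Bool) : twist σ (twist σ f) = f := by
  funext x; cases σ <;> simp [twist]

theorem twist_false {n : ℕ} (f : Votes n → Bool) : twist false f = f := by
  funext x; simp [twist]

theorem pr_twist {n : ℕ} (σ : Bool) (p : Votes n → Prop) :
    pr (fun x : Votes n => p (fun c => xor σ (x c))) = pr p := by
  rw [← pr_shift (fun _ => σ) p]
  exact uniformProb_congr fun x _ => by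
    rw [show shift (fun _ => σ) x = fun c => xor σ (x c) from
      funext fun c => by simp [shift, Bool.xor_comm]]

theorem pr_twist_ne {n : ℕ} (σ : Bool) (f g : Votes n → Bool) :
    pr (fun x => twist σ f x ≠ twist σ g x) = pr (fun x => f x ≠ g x) := by
  rw [← pr_twist σ fun x => f x ≠ g x]
  exact uniformProb_congr fun x _ => by simp [twist]

/-- The nonconstant functions that occur in exact solutions of the equations imposed by a
conclusion: oligarchies of at least two voters, their duals, and nonconstant affine functions.
Oligarchies of a single voter are affine. -/
inductive IsRigid {n : ℕ} : (Votes n → Bool) → Prop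
  | ofOligarchy (T : Finset (Fin n)) (hT : 2 ≤ T.card) (σ : Bool) :
      IsRigid (twist σ (oligarchy T))
  | ofAffine (χ : Votes n → Bool) (hχ : IsAdditive χ) (v : Votes n) (hv : χ v = true) (b : Bool) :
      IsRigid fun x => xor b (χ x)

theorem isRigid_twist_oligarchy {n : ℕ} {T : Finset (Fin n)} (hT : T.Nonempty) (σ : Bool) :
    IsRigid (twist σ (oligarchy T)) := by
  rcases lt_or_ge T.card 2 with h | h
  · obtain ⟨c, rfl⟩ := Finset.card_eq_one.1 (by have := hT.card_pos; omega : T.card = 1)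
    convert IsRigid.ofAffine (fun x : Votes n => x c) (fun u v => by simp [shift, Bool.xor_comm])
      (fun _ => true) rfl false using 1
    funext x
    cases σ <;> simp [twist, oligarchy]
  · exact IsRigid.ofOligarchy T h σ

/-- A voter of `T` outside `T'` votes `0` on half of the points where the oligarchy of `T'` is `1`,
and the oligarchies differ there. -/
theorem oligarchy_subset_of_close {n : ℕ} {T T' : Finset (Fin n)}
    (h : 2 * pr (fun x => oligarchy T x ≠ oligarchy T' x) < pr (fun x => oligarchy T' x = true)) :
    T ⊆ T' := by
  intro c hc
  by_contra hc'
  have h1 : pr (fun x => oligarchy T' x = true)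
      ≤ pr (fun x => oligarchy T' x = true ∧ x c = false)
        + pr (fun x => oligarchy T' (shift (indicator {c}) x) = true
          ∧ shift (indicator {c}) x c = false) := by
    refine uniformProb_le_add fun x _ hx => ?_
    cases h : x c
    · simp [hx]
    · right
      refine ⟨?_, by simp [shift, indicator, h]⟩
      rw [oligarchy_eq_true] at hx ⊢
      intro d hd
      have : d ≠ c := fun h => hc' (h ▸ hd)
      simp [shift, indicator, this, hx d hd]
  have h2 := pr_shift (indicator {c}) fun x => oligarchy T' x = true ∧ x c = false
  have h3 : pr (fun x => oligarchy T' x = true ∧ x c = false)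
      ≤ pr (fun x => oligarchy T x ≠ oligarchy T' x) := by
    refine uniformProb_mono fun x _ hx => ?_
    rw [hx.1]
    intro hT
    have := oligarchy_eq_true.1 hT c hc
    simp [hx.2] at this
  linarith

theorem pr_oligarchy_le {n : ℕ} {T : Finset (Fin n)} (hT : 2 ≤ T.card) :
    pr (fun x => oligarchy T x = true) ≤ 1 / 4 := by
  rw [pr_oligarchy]
  calc (1 / 2 : ℝ) ^ T.card ≤ (1 / 2) ^ 2 :=
        pow_le_pow_of_le_one (by norm_num) (by norm_num) hT
    _ = 1 / 4 := by norm_num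

theorem pr_twist_true_oligarchy_ge {n : ℕ} {T : Finset (Fin n)} (hT : 2 ≤ T.card) :
    3 / 4 ≤ pr (fun x => twist true (oligarchy T) x = true) := by
  have h1 := pr_oligarchy_le hT
  have h2 := pr_twist true fun x : Votes n => ¬ oligarchy T x = true
  have h3 := pr_not fun x => oligarchy T x = true
  have h4 : pr (fun x => twist true (oligarchy T) x = true)
      = pr (fun x : Votes n => ¬ oligarchy T (fun c => xor true (x c)) = true) :=
    uniformProb_congr fun x _ => by simp [twist]
  linarith

theorem pr_eq_true_le_add {n : ℕ} (f g : Votes n → Bool) :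
    pr (fun x => f x = true) ≤ pr (fun x => g x = true) + pr (fun x => f x ≠ g x) := by
  refine uniformProb_le_add fun x _ hx => ?_
  rw [hx]
  cases g x <;> simp

theorem pr_ne_comm {n : ℕ} (f g : Votes n → Bool) :
    pr (fun x => f x ≠ g x) = pr (fun x => g x ≠ f x) :=
  uniformProb_congr fun _ _ => ne_comm

theorem pr_ne_triangle {α : Type} [Fintype α] (f g h : α → Bool) :
    pr (fun x => f x ≠ h x) ≤ pr (fun x => f x ≠ g x) + pr (fun x => g x ≠ h x) := by
  refine uniformProb_le_add fun x _ hx => ?_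
  by_contra! h'
  exact hx (h'.1.trans h'.2)

/-- Distinct rigid functions are far apart unless one of them is close to a constant. -/
theorem IsRigid.eq_of_close {n : ℕ} {r s : Votes n → Bool} (hr : IsRigid r) (hs : IsRigid s)
    {θ : ℝ} (hθ0 : 0 < θ) (hθ1 : θ ≤ 1 / 10) (hrs : pr (fun x => r x ≠ s x) ≤ θ / 5)
    (hr' : ∀ b : Bool, θ / 2 ≤ pr (fun x => r x ≠ b))
    (hs' : ∀ b : Bool, θ / 2 ≤ pr (fun x => s x ≠ b)) : r = s := by
  have hrs' : pr (fun x => s x ≠ r x) ≤ θ / 5 := by rwa [pr_ne_comm]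
  have d1 := pr_eq_true_le_add r s
  have d2 := pr_eq_true_le_add s r
  have haff : ∀ (χ : Votes n → Bool), IsAdditive χ → ∀ v, χ v = true → ∀ b : Bool,
      pr (fun x => xor b (χ x) = true) = 1 / 2 := by
    intro χ hχ v hv b
    rw [← hχ.pr_eq_true hv (!b)]
    exact uniformProb_congr fun x _ => by cases b <;> simp
  cases hr with
  | ofOligarchy T hT σ =>
    cases hs with
    | ofOligarchy T' hT' σ' =>
      have hne : σ = σ' := by
        by_contra hne
        have a1 := pr_oligarchy_le hT
        have a2 := pr_oligarchy_le hT'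
        have a3 := pr_twist_true_oligarchy_ge hT
        have a4 := pr_twist_true_oligarchy_ge hT'
        cases σ <;> cases σ' <;> simp only [not_true_eq_false, twist_false] at * <;> linarith
      subst hne
      rw [pr_twist_ne] at hrs hrs'
      have hm : ∀ U : Finset (Fin n), pr (fun x => twist σ (oligarchy U) x ≠ σ)
          = pr (fun x => oligarchy U x = true) := by
        intro U
        rw [← pr_twist σ fun x => oligarchy U x = true]
        exact uniformProb_congr fun x _ => by cases σ <;> simp [twist]
      have h1 := hr' σ
      have h2 := hs' σ
      rw [hm] at h1 h2
      have : T = T' := (oligarchy_subset_of_close (by linarith)).antisymm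
        (oligarchy_subset_of_close (by linarith))
      rw [this]
    | ofAffine χ hχ v hv b =>
      exfalso
      have h1 := haff χ hχ v hv b
      cases σ
      · have a1 := pr_oligarchy_le hT
        simp only [twist_false] at *
        linarith
      · have a1 := pr_twist_true_oligarchy_ge hT
        linarith
  | ofAffine χ hχ v hv b =>
    have h1 := haff χ hχ v hv b
    cases hs with
    | ofOligarchy T hT σ =>
      exfalso
      cases σ
      · have a1 := pr_oligarchy_le hT
        simp only [twist_false] at *
        linarith
      · have a1 := pr_twist_true_oligarchy_ge hT
        linarith
    | ofAffine ψ hψ w hw b' =>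
      have hχψ : χ = ψ := by
        by_contra hne
        obtain ⟨u, hu⟩ := Function.ne_iff.1 hne
        have h2 := (hχ.add hψ).pr_eq_true (v := u) (by simpa using hu) (!xor b b')
        have h3 : pr (fun x => xor b (χ x) ≠ xor b' (ψ x)) = 1 / 2 := by
          rw [← h2]
          refine uniformProb_congr fun x _ => ?_
          cases b <;> cases b' <;> cases χ x <;> cases ψ x <;> simp
        linarith
      subst hχψ
      by_cases hb : b = b'
      · rw [hb]
      · have h3 : pr (fun x => xor b (χ x) ≠ xor b' (χ x)) = 1 :=
          uniformProb_true Finset.univ_nonempty fun x _ => by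
            cases b <;> cases b' <;> cases χ x <;> simp at hb ⊢
        linarith

/-- `g` is a rounding of `f` at scale `θ`: it is within `θ` of `f`, it is the constant that `f` is
`θ`-close to, and if there is no such constant, it is the rigid function that `f` is
`θ/10`-close to. -/
structure IsRounding {n : ℕ} (θ : ℝ) (f g : Votes n → Bool) : Prop where
  close : pr (fun x => f x ≠ g x) ≤ θ
  eq_const : ∀ b : Bool, pr (fun x => f x ≠ b) ≤ θ → ∀ x, g x = b
  eq_rigid : (∀ b : Bool, θ < pr (fun x => f x ≠ b)) →
    ∀ r, IsRigid r → pr (fun x => f x ≠ r x) ≤ θ / 10 → g = r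

theorem exists_isRounding {n : ℕ} (f : Votes n → Bool) {θ : ℝ} (hθ0 : 0 < θ)
    (hθ1 : θ ≤ 1 / 10) : ∃ g, IsRounding θ f g := by
  by_cases hc : ∃ b : Bool, pr (fun x => f x ≠ b) ≤ θ
  · obtain ⟨b, hb⟩ := hc
    refine ⟨fun _ => b, hb, fun b' hb' _ => ?_, fun h => absurd hb (not_le.2 (h b))⟩
    by_contra hne
    obtain ⟨x, hx⟩ := exists_of_pr_not_lt_one (p := fun x => f x = b ∧ f x = b') <| by
      refine (uniformProb_le_add (q := fun x => f x ≠ b) (r := fun x => f x ≠ b')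
        fun x _ hx => ?_).trans_lt ((add_le_add hb hb').trans_lt (by linarith))
      by_contra! h'
      exact hx h'
    exact hne (hx.1.symm.trans hx.2)
  push Not at hc
  by_cases hr : ∃ r, IsRigid r ∧ pr (fun x => f x ≠ r x) ≤ θ / 10
  · obtain ⟨r, hr, hfr⟩ := hr
    refine ⟨r, by linarith, fun b hb => absurd hb (not_le.2 (hc b)), fun _ s hs hfs => ?_⟩
    have far : ∀ t : Votes n → Bool, pr (fun x => f x ≠ t x) ≤ θ / 10 →
        ∀ b : Bool, θ / 2 ≤ pr (fun x => t x ≠ b) := by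
      intro t ht b
      have := pr_ne_triangle f t fun _ => b
      linarith [hc b]
    refine hr.eq_of_close hs hθ0 hθ1 ?_ (far r hfr) (far s hfs)
    have := pr_ne_triangle r f s
    rw [pr_ne_comm r f] at this
    linarith
  · exact ⟨f, (uniformProb_false fun x _ => by simp).trans_le hθ0.le,
      fun b hb => absurd hb (not_le.2 (hc b)),
      fun _ r hr' hfr => absurd ⟨r, hr', hfr⟩ hr⟩

/-- The oligarchy may be that of the empty set; then `f` is close to a constant, namely the one that
makes the literal true, and is rounded to it. -/
theorem IsRounding.eq_twist_oligarchy {n : ℕ} {θ : ℝ} {f g : Votes n → Bool}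
    (h : IsRounding θ f g) (hθ0 : 0 < θ) (hθ1 : θ ≤ 1 / 10) {σ : Bool} {T : Finset (Fin n)}
    (hσ : θ < pr (fun x => f x ≠ σ))
    (hT : pr (fun x => twist σ f x ≠ oligarchy T x) ≤ θ / 10) : g = twist σ (oligarchy T) := by
  have hT' : pr (fun x => f x ≠ twist σ (oligarchy T) x) ≤ θ / 10 := by
    rwa [← pr_twist_ne σ, twist_twist]
  rcases T.eq_empty_or_nonempty with rfl | hne
  · have he : ∀ x : Votes n, twist σ (oligarchy ∅) x = !σ := by
      intro x; cases σ <;> simp [twist, oligarchy]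
    funext x
    rw [he]
    refine h.eq_const (!σ) ?_ x
    simp only [he] at hT'
    linarith
  · refine h.eq_rigid (fun b => ?_) _ (isRigid_twist_oligarchy hne σ) hT'
    by_cases hb : b = σ
    · rwa [hb]
    by_contra! hcon
    have h1 : pr (fun x => oligarchy T x = true) ≤ 1 / 2 := by
      rw [pr_oligarchy]
      calc (1 / 2 : ℝ) ^ T.card ≤ (1 / 2) ^ 1 :=
            pow_le_pow_of_le_one (by norm_num) (by norm_num) hne.card_pos
        _ = 1 / 2 := by norm_num
    have h2 := pr_not fun x => oligarchy T x = true
    have h3 : pr (fun x => twist σ (oligarchy T) x ≠ b)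
        = pr (fun x => ¬ oligarchy T x = true) := by
      rw [← pr_twist σ]
      refine uniformProb_congr fun x _ => ?_
      cases σ <;> cases b <;> simp [twist] at hb ⊢
    have h4 := pr_ne_triangle (twist σ (oligarchy T)) f fun _ => b
    rw [pr_ne_comm _ f] at h4
    linarith

/-- The additive function may be zero; then `f` is close to a constant and is rounded to it. -/
theorem IsRounding.eq_affine {n : ℕ} {θ : ℝ} {f g : Votes n → Bool}
    (h : IsRounding θ f g) (hθ0 : 0 < θ) (hθ1 : θ ≤ 1 / 10) {χ : Votes n → Bool}
    (hχ : IsAdditive χ) {b : Bool} (hb : pr (fun x => f x ≠ xor b (χ x)) ≤ θ / 10) (x : Votes n) :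
    g x = xor b (χ x) := by
  by_cases hv : ∃ v, χ v = true
  · obtain ⟨v, hv⟩ := hv
    refine congrFun (h.eq_rigid (fun b' => ?_) _ (IsRigid.ofAffine χ hχ v hv b) hb) x
    by_contra! hcon
    have h1 : pr (fun x => xor b (χ x) ≠ b') = 1 / 2 := by
      rw [← hχ.pr_eq_true hv (!xor b b')]
      refine uniformProb_congr fun x _ => ?_
      cases b <;> cases b' <;> cases χ x <;> simp
    have h2 := pr_ne_triangle (fun x => xor b (χ x)) f fun _ => b'
    rw [pr_ne_comm _ f] at h2
    linarith
  · push Not at hv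
    simp only [Bool.not_eq_true] at hv
    simp only [hv] at hb ⊢
    rw [h.eq_const (xor b false) (by linarith) x]

/-! ### Conclusions -/

/-- The aggregation functions `g` on the premises can be completed by an aggregation function on
an issue with value `φ` of the premises. -/
def HasConclusion {ι : Type} {n : ℕ} (φ : (ι → Bool) → Bool) (g : ι → Votes n → Bool) : Prop :=
  ∃ h : Votes n → Bool, ∀ x : ι → Votes n, h (fun c => φ fun i => x i c) = φ fun i => g i (x i)

/-- The probability that aggregation by `f` on the premises and by `h` on an issue with value `φ`
of the premises gives inconsistent results. -/
noncomputable def conclusionError {ι : Type} [Fintype ι] {n : ℕ} (φ : (ι → Bool) → Bool)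
    (f : ι → Votes n → Bool) (h : Votes n → Bool) : ℝ :=
  pr fun x : ι → Votes n => h (fun c => φ fun i => x i c) ≠ φ fun i => f i (x i)

theorem hasConclusion_of_literal {ι : Type} {n : ℕ} {φ : (ι → Bool) → Bool} {i : ι} {s : Bool}
    (hφ : ∀ y, φ y = xor s (y i)) (g : ι → Votes n → Bool) : HasConclusion φ g :=
  ⟨twist s (g i), fun x => by simp [twist, hφ]⟩

theorem hasConclusion_of_conjunction {ι : Type} [Fintype ι] {n : ℕ} (hn : 1 ≤ n)
    {φ : (ι → Bool) → Bool} {S : Finset ι} {σ : ι → Bool} {τ : Bool}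
    (hφ : ∀ y, φ y = xor τ (decide (∀ i ∈ S, xor (σ i) (y i) = true)))
    {f g : ι → Votes n → Bool} {h : Votes n → Bool} {η θ : ℝ} (hθ0 : 0 < θ) (hθ1 : θ ≤ 1 / 10)
    (hηθ : 800 * (n : ℝ) ^ 2 * η ≤ θ ^ (Fintype.card ι + 4))
    (hη : conclusionError φ f h ≤ η)
    (hfg : ∀ i, IsRounding θ (f i) (g i)) (hS : 2 ≤ S.card) : HasConclusion φ g := by
  by_cases hk : ∃ i ∈ S, pr (fun x => f i x ≠ σ i) ≤ θ
  · -- a premise rounded to the constant that falsifies its literal makes the conclusion constant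
    obtain ⟨i, hi, hk⟩ := hk
    refine ⟨fun _ => τ, fun x => ?_⟩
    have hc := (hfg i).eq_const (σ i) hk
    have : ¬ ∀ k ∈ S, xor (σ k) (g k (x k)) = true := fun hall => by
      have := hall i hi
      simp [hc] at this
    rw [hφ]
    simp only [this, decide_false, Bool.xor_false]
  push Not at hk
  set e : (ι → Votes n) → (ι → Votes n) := fun x i c => xor (σ i) (x i c) with he
  have hinv : Function.Involutive e := fun x => by funext i c; simp [he]
  obtain ⟨T, hT⟩ := conj_rigidity (f := twist τ h) (g := fun i => twist (σ i) (f i)) (S := S) hn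
    hθ0 hθ1 hηθ (by
      refine le_trans (le_of_eq ?_) hη
      unfold conclusionError
      rw [← pr_comp_equiv hinv.toPerm]
      refine uniformProb_congr fun x _ => ?_
      simp only [Function.Involutive.coe_toPerm, he, hφ, twist, ne_eq]
      simp only [← Bool.xor_assoc, Bool.xor_self, Bool.false_xor]
      show _ ↔ ¬ h _ = _
      generalize h _ = a
      generalize decide (∀ i ∈ S, xor (σ i) (f i fun c => xor (σ i) (x i c)) = true) = b
      cases τ <;> cases a <;> cases b <;> simp) (fun i hi => by
      refine (hk i hi).le.trans (le_of_eq ?_)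
      rw [← pr_twist (σ i)]
      refine uniformProb_congr fun x _ => ?_
      simp only [twist]
      generalize f i _ = a
      cases σ i <;> cases a <;> simp) hS
  have hg : ∀ i ∈ S, g i = twist (σ i) (oligarchy T) := fun i hi =>
    (hfg i).eq_twist_oligarchy hθ0 hθ1 (hk i hi) (hT i hi)
  refine ⟨twist τ (oligarchy T), fun x => ?_⟩
  rw [hφ]
  simp only [hφ, twist, ← Bool.xor_assoc, Bool.xor_self, Bool.false_xor]
  congr 1
  rw [Bool.eq_iff_iff, oligarchy_eq_true, decide_eq_true_iff]
  have h1 : ∀ i ∈ S, (xor (σ i) (g i (x i)) = true ↔ ∀ c ∈ T, xor (σ i) (x i c) = true) := by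
    intro i hi
    rw [hg i hi, ← oligarchy_eq_true]
    simp [twist]
  simp only [decide_eq_true_iff]
  exact ⟨fun hall i hi => (h1 i hi).2 fun c hc => hall c hc i hi,
    fun hall c hc i hi => (h1 i hi).1 (hall i hi) c hc⟩

/-- The exclusive or of the inputs in `S`. -/
def parity {ι : Type} (S : Finset ι) (y : ι → Bool) : Bool :=
  decide (Odd (S.filter fun i => y i = true).card)

theorem parity_insert {ι : Type} {S : Finset ι} {i : ι} (hi : i ∉ S) (y : ι → Bool) :
    parity (insert i S) y = xor (y i) (parity S y) := by
  unfold parity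
  rw [Finset.filter_insert]
  cases h : y i
  · simp
  · have : i ∉ S.filter fun i => y i = true := fun h => hi (Finset.mem_filter.1 h).1
    simp only [if_true, Finset.card_insert_of_notMem this, Nat.odd_add_one, decide_not,
      Bool.true_xor]

theorem parity_xor {ι : Type} (S : Finset ι) (y z : ι → Bool) :
    parity S (fun i => xor (y i) (z i)) = xor (parity S y) (parity S z) := by
  induction S using Finset.induction_on with
  | empty => simp [parity]
  | insert i S hi ih =>
    rw [parity_insert hi, parity_insert hi, parity_insert hi, ih]
    cases y i <;> cases z i <;> cases parity S y <;> cases parity S z <;> rfl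

theorem parity_update {ι : Type} {S : Finset ι} {i : ι} (hi : i ∈ S) (y : ι → Bool) (a : Bool) :
    parity S (Function.update y i (xor (y i) a)) = xor (parity S y) a := by
  have h1 : Function.update y i (xor (y i) a)
      = fun k => xor (y k) (Function.update (fun _ => false) i a k) := by
    funext k
    by_cases hk : k = i
    · subst hk; simp
    · simp [hk]
  have h2 : ∀ R : Finset ι, i ∉ R → parity R (Function.update (fun _ => false) i a) = false := by
    intro R hR
    unfold parity
    rw [Finset.filter_false_of_mem]
    · simp
    · intro k hk
      have : k ≠ i := fun h => hR (h ▸ hk)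
      simp [this]
  rw [h1, parity_xor, ← Finset.insert_erase hi,
    parity_insert (Finset.notMem_erase i S) (Function.update _ i a), h2 _ (Finset.notMem_erase i S)]
  simp

theorem IsAdditive.apply_false {n : ℕ} {χ : Votes n → Bool} (h : IsAdditive χ) :
    χ (fun _ => false) = false := by
  have h1 := h (fun _ => false) fun _ => false
  have h2 : shift (fun _ : Fin n => false) (fun _ => false) = fun _ => false := by
    funext c; simp [shift]
  rw [h2] at h1
  simpa using h1

theorem IsAdditive.apply_parity {ι : Type} {n : ℕ} {χ : Votes n → Bool} (h : IsAdditive χ)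
    (S : Finset ι) (x : ι → Votes n) :
    χ (fun c => parity S fun i => x i c) = parity S fun i => χ (x i) := by
  induction S using Finset.induction_on with
  | empty => simpa [parity] using h.apply_false
  | insert i S hi ih =>
    simp only [parity_insert hi, ← ih, ← h (x i)]
    congr 1
    funext c
    simp [shift, Bool.xor_comm]

theorem hasConclusion_of_parity {ι : Type} [Fintype ι] {n : ℕ}
    {φ : (ι → Bool) → Bool} {S : Finset ι} {τ : Bool} (hφ : ∀ y, φ y = xor τ (parity S y))
    {f g : ι → Votes n → Bool} {h : Votes n → Bool} {η θ : ℝ} (hθ0 : 0 < θ) (hθ1 : θ ≤ 1 / 10)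
    (hηθ : 40 * η ≤ θ) (hη : conclusionError φ f h ≤ η)
    (hfg : ∀ i, IsRounding θ (f i) (g i)) (hS : 2 ≤ S.card) : HasConclusion φ g := by
  obtain ⟨χ, hχ, hb⟩ := xor_rigidity (S := S) (φ := φ)
    (fun i hi y a => by rw [hφ, hφ, parity_update hi, Bool.xor_assoc]) (by linarith) hη hS
  have hb' : ∀ i, ∃ b : Bool, i ∈ S → pr (fun x => f i x ≠ xor b (χ x)) ≤ 4 * η := by
    intro i
    by_cases hi : i ∈ S
    · obtain ⟨b, hb⟩ := hb i hi
      exact ⟨b, fun _ => hb⟩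
    · exact ⟨false, fun h => absurd h hi⟩
  choose b hb' using hb'
  have hg : ∀ i ∈ S, ∀ x, g i x = xor (b i) (χ x) := fun i hi x =>
    (hfg i).eq_affine hθ0 hθ1 hχ ((hb' i hi).trans (by linarith)) x
  -- `φ` commutes with `χ` up to the constant `τ`, which the translation removes from `y`
  refine ⟨fun y => xor (xor τ (parity S b)) (χ (shift (fun _ => τ) y)), fun x => ?_⟩
  have h1 : shift (fun _ => τ) (fun c => φ fun i => x i c) = fun c => parity S fun i => x i c := by
    funext c
    rw [shift_apply, hφ]
    cases τ <;> cases parity S fun i => x i c <;> rfl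
  have h2 : parity S (fun i => g i (x i)) = parity S fun i => xor (b i) (χ (x i)) := by
    unfold parity
    congr 2
    refine congrArg _ (Finset.filter_congr fun i hi => ?_)
    simp only [hg i hi]
  simp only [h1]
  rw [hφ, h2, parity_xor, hχ.apply_parity, Bool.xor_assoc]

theorem IsXor.exists_parity {ι : Type} {φ : (ι → Bool) → Bool} (h : IsXor φ) :
    ∃ (S : Finset ι) (τ : Bool), S.Nonempty ∧ ∀ y, φ y = xor τ (parity S y) := by
  obtain ⟨S, σ, τ, hS, hφ⟩ := h
  refine ⟨S, xor τ (parity S σ), hS, fun y => ?_⟩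
  rw [hφ, Bool.xor_assoc, ← parity_xor]
  rfl

/-- Compatibility with a conclusion is automatic when it is a conjunction or exclusive or of a
single premise, as it is then that premise or its negation; so it only has to be shown for those
of at least two premises. -/
theorem hasConclusion_of_two_le_card {ι : Type} [Fintype ι] {n : ℕ} {φ : (ι → Bool) → Bool}
    (hφ : IsConjunction φ ∨ IsXor φ) (g : ι → Votes n → Bool)
    (h : ∀ (S : Finset ι) (σ : ι → Bool) (τ : Bool), 2 ≤ S.card →
        (∀ y, φ y = xor τ (decide (∀ i ∈ S, xor (σ i) (y i) = true))) → HasConclusion φ g)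
    (h' : ∀ (S : Finset ι) (τ : Bool), 2 ≤ S.card →
        (∀ y, φ y = xor τ (parity S y)) → HasConclusion φ g) :
    HasConclusion φ g := by
  rcases hφ with ⟨S, σ, τ, hS, hφ⟩ | hφ
  · rcases lt_or_ge S.card 2 with hc | hc
    · obtain ⟨i, rfl⟩ := Finset.card_eq_one.1 (by have := hS.card_pos; omega : S.card = 1)
      refine hasConclusion_of_literal (i := i) (s := xor τ (σ i)) (fun y => ?_) g
      rw [hφ, Bool.xor_assoc]
      congr 1
      simp only [Finset.mem_singleton, forall_eq, Bool.decide_eq_true]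
    · exact h S σ τ hc fun y => (hφ y).trans (by congr)
  · obtain ⟨S, τ, hS, hφ⟩ := hφ.exists_parity
    rcases lt_or_ge S.card 2 with hc | hc
    · obtain ⟨i, rfl⟩ := Finset.card_eq_one.1 (by have := hS.card_pos; omega : S.card = 1)
      refine hasConclusion_of_literal (i := i) (s := τ) (fun y => ?_) g
      rw [hφ, ← insert_empty_eq, parity_insert (Finset.notMem_empty i)]
      simp [parity]
    · exact h' S τ hc hφ

/-- Aggregation functions on the premises that are nearly compatible with all conclusions can be
rounded to nearby ones that are exactly compatible. -/
theorem exists_hasConclusion_of_conclusionError_le {ι J : Type} [Fintype ι] {n : ℕ} (hn : 1 ≤ n)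
    {φ : J → (ι → Bool) → Bool} (hφ : ∀ j, IsConjunction (φ j) ∨ IsXor (φ j))
    {f : ι → Votes n → Bool} {h : J → Votes n → Bool} {η θ : ℝ} (hθ0 : 0 < θ) (hθ1 : θ ≤ 1 / 10)
    (hηθ : 800 * (n : ℝ) ^ 2 * η ≤ θ ^ (Fintype.card ι + 4))
    (hη : ∀ j, conclusionError (φ j) f (h j) ≤ η) :
    ∃ g : ι → Votes n → Bool, (∀ i, pr (fun x => f i x ≠ g i x) ≤ θ) ∧
      ∀ j, HasConclusion (φ j) g := by
  choose g hg using fun i => exists_isRounding (f i) hθ0 hθ1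
  refine ⟨g, fun i => (hg i).close, fun j => hasConclusion_of_two_le_card (hφ j) g
    (fun S σ τ hS hj => ?_) (fun S τ hS hj => ?_)⟩
  · exact hasConclusion_of_conjunction hn hj hθ0 hθ1 hηθ (hη j) hg hS
  · have h0 : 0 ≤ η := (uniformProb_nonneg _ _).trans (hη j)
    have h1 : θ ^ (Fintype.card ι + 4) ≤ θ ^ 1 :=
      pow_le_pow_of_le_one hθ0.le (by linarith) (by omega)
    have h2 : (1 : ℝ) ≤ (n : ℝ) ^ 2 := one_le_pow₀ (by exact_mod_cast hn)
    exact hasConclusion_of_parity hj hθ0 hθ1 (by nlinarith) (hη j) hg hS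

/-! ### From mechanisms to aggregation functions -/

theorem mem_consistentProfiles {n m : ℕ} {A : Agenda m} {X : Profile n m} :
    X ∈ consistentProfiles n A ↔ ∀ i, X i ∈ A := by
  simp [consistentProfiles, Fintype.mem_piFinset]

theorem dist_triangle {n m : ℕ} (A : Agenda m) (F G H : Mechanism n m) :
    dist A F H ≤ dist A F G + dist A G H := by
  refine uniformProb_le_add fun X _ hX => ?_
  by_contra! h
  exact hX (h.1.trans h.2)

theorem dist_comm {n m : ℕ} (A : Agenda m) (F G : Mechanism n m) : dist A F G = dist A G F :=
  uniformProb_congr fun _ _ => ne_comm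

theorem inconsistencyIndex_le_add_dist {n m : ℕ} (A : Agenda m) (F G : Mechanism n m) :
    inconsistencyIndex A G ≤ inconsistencyIndex A F + dist A F G := by
  refine uniformProb_le_add fun X _ hX => ?_
  by_contra! h
  exact hX (h.2 ▸ h.1)

/-- Taking, issue by issue, the more frequent outcome among the profiles with the same votes on
the issue turns a mechanism into an independent one nearby. -/
theorem exists_isIndependent_dist_le {n m : ℕ} (A : Agenda m) (F : Mechanism n m) {δ : ℝ}
    (hF : dependencyIndex A F ≤ δ) :
    ∃ H : Mechanism n m, IsIndependent A H ∧ dist A F H ≤ 2 * m * δ := by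
  set C : Profile n m → Fin m → Finset (Profile n m) := fun X j =>
    (consistentProfiles n A).filter fun Y => ∀ i, X i j = Y i j with hC
  set H : Mechanism n m := fun X j =>
    decide (1 / 2 ≤ uniformProb (C X j) fun Y => F Y j = true) with hH
  refine ⟨H, fun X _ Y _ j hXY => ?_, ?_⟩
  · have : C X j = C Y j := Finset.filter_congr fun Z _ => by simp only [hXY]
    simp only [hH, this]
  have hj : ∀ j, uniformProb (consistentProfiles n A) (fun X => F X j ≠ H X j) ≤ 2 * δ := by
    intro j
    have h1 : dependencyIndexAt A F j ≤ δ :=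
      (le_ciSup (Set.finite_range fun j => dependencyIndexAt A F j).bddAbove j).trans hF
    -- a profile whose outcome is not the more frequent one disagrees with at least half its fibre
    have h2 : ∀ X ∈ consistentProfiles n A, (if F X j ≠ H X j then (1 : ℝ) else 0)
        ≤ 2 * uniformProb (C X j) fun Y => F X j ≠ F Y j := by
      intro X hX
      split_ifs with h
      · have hne : (C X j).Nonempty := ⟨X, Finset.mem_filter.2 ⟨hX, fun _ => rfl⟩⟩
        have hsum : (1 : ℝ) ≤ uniformProb (C X j) (fun Y => F Y j = true)
            + uniformProb (C X j) (fun Y => F Y j = false) := by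
          rw [← uniformProb_true hne (p := fun _ => True) fun _ _ => trivial]
          refine uniformProb_le_add fun Y _ _ => ?_
          cases F Y j <;> simp
        by_cases hm : 1 / 2 ≤ uniformProb (C X j) fun Y => F Y j = true
        · have hHX : H X j = true := by simp only [hH, hm, decide_true]
          have hFX : F X j = false := by rw [hHX] at h; simpa using h
          have : uniformProb (C X j) (fun Y => F X j ≠ F Y j)
              = uniformProb (C X j) fun Y => F Y j = true :=
            uniformProb_congr fun Y _ => by rw [hFX]; cases F Y j <;> simp
          linarith
        · have hHX : H X j = false := by simp only [hH, hm, decide_false]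
          have hFX : F X j = true := by rw [hHX] at h; simpa using h
          have : uniformProb (C X j) (fun Y => F X j ≠ F Y j)
              = uniformProb (C X j) fun Y => F Y j = false :=
            uniformProb_congr fun Y _ => by rw [hFX]; cases F Y j <;> simp
          linarith [not_le.1 hm]
      · have := uniformProb_nonneg (C X j) fun Y => F X j ≠ F Y j
        linarith
    calc uniformProb (consistentProfiles n A) (fun X => F X j ≠ H X j)
        = (∑ X ∈ consistentProfiles n A, if F X j ≠ H X j then (1 : ℝ) else 0)
            / (consistentProfiles n A).card := by
          rw [uniformProb_eq, Finset.sum_boole]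
      _ ≤ (∑ X ∈ consistentProfiles n A, 2 * uniformProb (C X j) fun Y => F X j ≠ F Y j)
            / (consistentProfiles n A).card := by
          gcongr with X hX
          exact h2 X hX
      _ = 2 * dependencyIndexAt A F j := by
          rw [← Finset.mul_sum, mul_div_assoc]
          rfl
      _ ≤ 2 * δ := by linarith
  calc dist A F H ≤ uniformProb (consistentProfiles n A)
          (fun X => ∃ j ∈ (Finset.univ : Finset (Fin m)), F X j ≠ H X j) :=
        uniformProb_mono fun X _ hX => by simpa using Function.ne_iff.1 hX
    _ ≤ ∑ j : Fin m, uniformProb (consistentProfiles n A) fun X => F X j ≠ H X j :=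
        uniformProb_exists_le _ _ _
    _ ≤ ∑ _j : Fin m, 2 * δ := Finset.sum_le_sum fun j _ => hj j
    _ = 2 * m * δ := by simp; ring

theorem IsIndependent.exists_eq {n m : ℕ} {A : Agenda m} {H : Mechanism n m}
    (hH : IsIndependent A H) : ∃ f : Fin m → Votes n → Bool,
      ∀ X ∈ consistentProfiles n A, ∀ j, H X j = f j fun i => X i j := by
  refine ⟨fun j v => decide (∃ X ∈ consistentProfiles n A, (∀ i, X i j = v i) ∧ H X j = true),
    fun X hX j => ?_⟩
  rw [Bool.eq_iff_iff, decide_eq_true_iff]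
  refine ⟨fun h => ⟨X, hX, fun _ => rfl, h⟩, ?_⟩
  rintro ⟨Y, hY, hXY, h⟩
  rw [hH X hX Y hY j fun i => (hXY i).symm, h]

/-- The consistent profile with the given votes on the premises. -/
def extendProfile {n m : ℕ} {P : Finset (Fin m)} (Φ : Fin m → (P → Bool) → Bool)
    (x : P → Votes n) : Profile n m :=
  fun i j => if h : j ∈ P then x ⟨j, h⟩ i else Φ j fun k => x k i

theorem extendProfile_premise {n m : ℕ} {P : Finset (Fin m)} (Φ : Fin m → (P → Bool) → Bool)
    (x : P → Votes n) (i : Fin n) (k : P) : extendProfile Φ x i k = x k i := by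
  simp [extendProfile]

theorem extendProfile_conclusion {n m : ℕ} {P : Finset (Fin m)} (Φ : Fin m → (P → Bool) → Bool)
    (x : P → Votes n) (i : Fin n) {j : Fin m} (hj : j ∉ P) :
    extendProfile Φ x i j = Φ j fun k => x k i := by
  simp [extendProfile, hj]

theorem bijOn_extendProfile {n m : ℕ} {A : Agenda m} {P : Finset (Fin m)}
    {Φ : Fin m → (P → Bool) → Bool} (hA : IsTruthFunctional A P Φ) :
    Set.BijOn (extendProfile (n := n) Φ) Set.univ (consistentProfiles n A : Set (Profile n m)) := by
  refine ⟨fun x _ => ?_, fun x _ y _ hxy => ?_, fun X hX => ⟨fun k i => X i k, trivial, ?_⟩⟩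
  · rw [Finset.mem_coe, mem_consistentProfiles]
    intro i
    rw [hA]
    intro j hj
    rw [extendProfile_conclusion Φ x i hj]
    simp only [extendProfile_premise]
  · funext k i
    rw [← extendProfile_premise Φ x, hxy, extendProfile_premise]
  · rw [Finset.mem_coe, mem_consistentProfiles] at hX
    funext i j
    by_cases hj : j ∈ P
    · exact extendProfile_premise Φ (fun k i => X i k) i ⟨j, hj⟩
    · rw [extendProfile_conclusion Φ _ i hj, (hA (X i)).1 (hX i) j hj]

/-- On a truth-functional agenda, aggregation functions on the premises that are compatible with
all conclusions define an independent and consistent mechanism. Its distance to an independent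
mechanism is controlled by the distances on the premises. -/
theorem exists_isConsistent_dist_le {n m : ℕ} {A : Agenda m} {P : Finset (Fin m)}
    {Φ : Fin m → (P → Bool) → Bool} (hA : IsTruthFunctional A P Φ) {H : Mechanism n m}
    {f : Fin m → Votes n → Bool}
    (hf : ∀ X ∈ consistentProfiles n A, ∀ j, H X j = f j fun i => X i j)
    {g : P → Votes n → Bool} {θ : ℝ} (hg : ∀ k : P, pr (fun x => f k x ≠ g k x) ≤ θ)
    (hc : ∀ j, j ∉ P → HasConclusion (Φ j) g) :
    ∃ G : Mechanism n m, IsIndependent A G ∧ IsConsistent A G ∧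
      dist A H G ≤ inconsistencyIndex A H + P.card * θ := by
  have hc' : ∀ j, ∃ h : Votes n → Bool, j ∉ P → ∀ x : P → Votes n,
      h (fun c => Φ j fun i => x i c) = Φ j fun i => g i (x i) := by
    intro j
    by_cases hj : j ∈ P
    · exact ⟨fun _ => false, fun h => absurd hj h⟩
    · obtain ⟨h, hh⟩ := hc j hj
      exact ⟨h, fun _ => hh⟩
  choose h hh using hc'
  set G : Mechanism n m := fun X j =>
    if hj : j ∈ P then g ⟨j, hj⟩ (fun i => X i j) else h j fun i => X i j with hG
  have hGp : ∀ X (k : P), G X k = g k fun i => X i k := fun X k => by simp [hG]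
  have hGc : ∀ X, ∀ j ∉ P, G X j = h j fun i => X i j := fun X j hj => by simp [hG, hj]
  have hcons : IsConsistent A G := by
    intro X hX
    rw [mem_consistentProfiles] at hX
    rw [hA]
    intro j hj
    simp only [hGc X j hj, hGp]
    rw [← hh j hj fun k i => X i k]
    congr 1
    funext i
    exact (hA (X i)).1 (hX i) j hj
  refine ⟨G, fun X _ Y _ j hXY => ?_, hcons, ?_⟩
  · have : (fun i => X i j) = fun i => Y i j := funext hXY
    simp only [hG, this]
  · have h1 : dist A H G ≤ inconsistencyIndex A H + uniformProb (consistentProfiles n A)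
        fun X => ∃ k ∈ (Finset.univ : Finset P), f k (fun i => X i k) ≠ g k fun i => X i k := by
      refine uniformProb_le_add fun X hX hne => ?_
      by_contra! hcon
      obtain ⟨h1, h2⟩ := hcon
      have hp : ∀ k : P, H X k = G X k := fun k => by
        rw [hf X hX, hGp, h2 k (Finset.mem_univ k)]
      refine hne (funext fun j => ?_)
      by_cases hj : j ∈ P
      · exact hp ⟨j, hj⟩
      · rw [(hA _).1 h1 j hj, (hA _).1 (hcons X hX) j hj]
        simp only [hp]
    refine h1.trans (add_le_add le_rfl ((uniformProb_exists_le _ _ _).trans ?_))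
    calc _ ≤ ∑ _k : P, θ := by
          refine Finset.sum_le_sum fun k _ => ?_
          refine le_trans (le_of_eq ?_) ((pr_pi_single k fun v => f k v ≠ g k v).trans_le (hg k))
          exact (uniformProb_eq_pr _ (bijOn_extendProfile hA) _).trans
            (uniformProb_congr fun x _ => by simp only [extendProfile_premise])
      _ = P.card * θ := by simp

theorem conclusionError_le_inconsistencyIndex {n m : ℕ} {A : Agenda m} {P : Finset (Fin m)}
    {Φ : Fin m → (P → Bool) → Bool} (hA : IsTruthFunctional A P Φ) {H : Mechanism n m}
    {f : Fin m → Votes n → Bool}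
    (hf : ∀ X ∈ consistentProfiles n A, ∀ j, H X j = f j fun i => X i j) {j : Fin m}
    (hj : j ∉ P) :
    conclusionError (Φ j) (fun k : P => f k) (f j) ≤ inconsistencyIndex A H := by
  unfold conclusionError
  refine (uniformProb_mono fun x _ hx hmem => hx ?_).trans
    (uniformProb_eq_pr (extendProfile Φ) (bijOn_extendProfile hA) fun X => H X ∉ A).ge
  have hX := (bijOn_extendProfile hA).mapsTo (Set.mem_univ x)
  have h1 := (hA _).1 hmem j hj
  rw [hf _ hX] at h1
  simp only [hf _ hX, extendProfile_premise, extendProfile_conclusion Φ x _ hj] at h1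
  exact h1

/-- An independent mechanism that is nearly consistent is close to one that is independent and
consistent. -/
theorem IsIndependent.exists_isConsistent_dist_le {n m : ℕ} (hm : 1 ≤ m) (hn : 1 ≤ n)
    {A : Agenda m} (hA : IsConjunctionXorAgenda A) {H : Mechanism n m} (hH : IsIndependent A H)
    {δ θ : ℝ} (hθ0 : 0 < θ) (hθ1 : m * θ ≤ 1 / 10)
    (hδ : (n : ℝ) ^ 2 * δ ≤ θ ^ (m ^ 2 + m - 1))
    (hHδ : inconsistencyIndex A H ≤ (2 * m + 1) * δ) :
    ∃ G : Mechanism n m, IsIndependent A G ∧ IsConsistent A G ∧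
      dist A H G ≤ (2 * m + 1) * δ + m * θ := by
  obtain ⟨P, Φ, hA, hΦ⟩ := hA
  obtain ⟨f, hf⟩ := hH.exists_eq
  have hm' : (1 : ℝ) ≤ m := by exact_mod_cast hm
  have hθ1' : θ ≤ 1 / 10 := by nlinarith
  obtain ⟨g, hg, hc⟩ : ∃ g : P → Votes n → Bool, (∀ k : P, pr (fun x => f k x ≠ g k x) ≤ θ) ∧
      ∀ j : {j // j ∉ P}, HasConclusion (Φ j) g := by
    rcases lt_or_ge P.card 2 with hP | hP
    · -- a conclusion from a single premise is compatible with every aggregation function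
      refine ⟨fun k => f k, fun k => (uniformProb_false fun x _ => by simp).trans_le hθ0.le,
        fun j => hasConclusion_of_two_le_card (hΦ j j.2) _ (fun S _ _ hS _ => ?_)
          fun S _ hS _ => ?_⟩
      all_goals
        have := Finset.card_le_univ S
        rw [Fintype.card_coe] at this
        omega
    by_cases hj : ∃ j, j ∉ P
    · have hPm : P.card + 1 ≤ m := by
        obtain ⟨j, hj⟩ := hj
        simpa [hj] using Finset.card_le_univ (insert j P)
      refine exists_hasConclusion_of_conclusionError_le hn (J := {j // j ∉ P})
        (φ := fun j => Φ j) (fun j => hΦ j j.2) (f := fun k : P => f k)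
        (h := fun j => f j) hθ0 hθ1' (η := (2 * m + 1) * δ) ?_
        fun j => (conclusionError_le_inconsistencyIndex hA hf j.2).trans hHδ
      rw [Fintype.card_coe]
      have hm3 : (3 : ℝ) ≤ m := by exact_mod_cast (by omega : 3 ≤ m)
      have hexp : m ^ 2 + m - 1 = (m + 3) + (m ^ 2 - 4) := by
        have : 3 * 3 ≤ m ^ 2 := by nlinarith
        omega
      have h5 : θ ^ (m ^ 2 - 4) ≤ θ ^ 5 := by
        refine pow_le_pow_of_le_one hθ0.le (by linarith) ?_
        have : 3 * 3 ≤ m ^ 2 := by nlinarith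
        omega
      have hm3' : θ ^ (m + 3) ≤ θ ^ (P.card + 4) :=
        pow_le_pow_of_le_one hθ0.le (by linarith) (by omega)
      have hθ30 : θ ≤ 1 / 30 := by nlinarith
      -- with at least three issues, the exponent leaves room for the constants
      have h4 : θ ^ 4 ≤ (1 / 30) ^ 4 := by gcongr
      have hsmall : 800 * (2 * m + 1) * θ ^ 5 ≤ 1 := by
        have : (2 * m + 1) * θ ≤ 3 / 10 := by nlinarith
        calc 800 * (2 * m + 1) * θ ^ 5 = 800 * ((2 * m + 1) * θ) * θ ^ 4 := by ring
          _ ≤ 800 * (3 / 10) * (1 / 30) ^ 4 := by gcongr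
          _ ≤ 1 := by norm_num
      calc 800 * (n : ℝ) ^ 2 * ((2 * m + 1) * δ)
          = 800 * (2 * m + 1) * ((n : ℝ) ^ 2 * δ) := by ring
        _ ≤ 800 * (2 * m + 1) * (θ ^ (m + 3) * θ ^ 5) := by
            rw [hexp, pow_add] at hδ
            exact mul_le_mul_of_nonneg_left (hδ.trans (by gcongr)) (by positivity)
        _ = θ ^ (m + 3) * (800 * (2 * m + 1) * θ ^ 5) := by ring
        _ ≤ θ ^ (m + 3) * 1 := by gcongr
        _ ≤ θ ^ (P.card + 4) := by rwa [mul_one]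
    · push Not at hj
      exact ⟨fun k => f k, fun k => (uniformProb_false fun x _ => by simp).trans_le hθ0.le,
        fun j => absurd (hj j) j.2⟩
  obtain ⟨G, hG1, hG2, hG3⟩ :=
    JudgementAggregation.exists_isConsistent_dist_le hA hf hg fun j hj => hc ⟨j, hj⟩
  refine ⟨G, hG1, hG2, hG3.trans (add_le_add hHδ ?_)⟩
  gcongr
  simpa using Finset.card_le_univ P

end JudgementAggregation

theorem mainTheorem2 (m n : ℕ) (hm : 1 ≤ m) (hn : 1 ≤ n) (ε δ : ℝ)
    (hε : ε ∈ Set.Icc (0 : ℝ) 1) (hδ : δ ∈ Set.Icc (0 : ℝ) 1)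
    (hδε : δ < (n : ℝ) ^ (-2 : ℤ) * (ε / (10 * (m : ℝ))) ^ (m ^ 2 + m - 1))
    (A : JudgementAggregation.Agenda m)
    (hA : JudgementAggregation.IsConjunctionXorAgenda A) :
    (¬ ∃ F : JudgementAggregation.Mechanism n m,
      JudgementAggregation.dependencyIndex A F ≤ δ ∧
      JudgementAggregation.inconsistencyIndex A F ≤ δ ∧
      JudgementAggregation.IsFarFromIndependentConsistent A ε F) ∧
    (¬ ∃ F : JudgementAggregation.Mechanism n m,
      JudgementAggregation.IsCloseToIndependent A δ F ∧
      JudgementAggregation.IsCloseToConsistent A δ F ∧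
      JudgementAggregation.IsFarFromIndependentConsistent A ε F) := by
  have hm' : (1 : ℝ) ≤ m := by exact_mod_cast hm
  have hn' : (1 : ℝ) ≤ n := by exact_mod_cast hn
  have hexp : m ^ 2 + m - 1 ≠ 0 := by
    have : 1 ≤ m ^ 2 := Nat.one_le_pow _ _ hm
    omega
  set θ : ℝ := ε / (10 * (m : ℝ)) with hθ
  have hmθ : m * θ = ε / 10 := by rw [hθ]; field_simp
  have hθ0 : 0 < θ := by
    refine lt_of_le_of_ne (div_nonneg hε.1 (by positivity)) fun h => ?_
    rw [← h, zero_pow hexp, mul_zero] at hδε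
    linarith [hδ.1]
  have hθ1 : θ ≤ 1 := by nlinarith [hε.2]
  have hδn : (n : ℝ) ^ 2 * δ < θ ^ (m ^ 2 + m - 1) := by
    have : (n : ℝ) ^ (-2 : ℤ) = ((n : ℝ) ^ 2)⁻¹ := by
      rw [zpow_neg]; norm_cast
    rw [this, inv_mul_eq_div, lt_div_iff₀ (by positivity)] at hδε
    linarith
  have hδθ : δ ≤ θ := by
    have h1 : θ ^ (m ^ 2 + m - 1) ≤ θ := pow_le_of_le_one hθ0.le hθ1 hexp
    have h2 : (1 : ℝ) ≤ (n : ℝ) ^ 2 := one_le_pow₀ hn'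
    nlinarith [hδ.1]
  have hε0 : 0 < ε := by nlinarith
  -- both notions of approximate independence and consistency reduce to this statement
  have key : ∀ F H : JudgementAggregation.Mechanism n m, JudgementAggregation.IsIndependent A H →
      JudgementAggregation.dist A F H ≤ 2 * m * δ →
      JudgementAggregation.inconsistencyIndex A F ≤ δ →
      ¬ JudgementAggregation.IsFarFromIndependentConsistent A ε F := by
    intro F H hH hFH hF hfar
    have hHδ : JudgementAggregation.inconsistencyIndex A H ≤ (2 * m + 1) * δ := by
      have := JudgementAggregation.inconsistencyIndex_le_add_dist A F H
      linarith
    obtain ⟨G, hG1, hG2, hG3⟩ := hH.exists_isConsistent_dist_le hm hn hA hθ0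
      (by rw [hmθ]; linarith [hε.2]) hδn.le hHδ
    have h1 := hfar G hG1 hG2
    have h2 := JudgementAggregation.dist_triangle A F H G
    have h3 : (m : ℝ) * δ ≤ m * θ := by gcongr
    have h4 : δ ≤ m * δ := by nlinarith [hδ.1]
    nlinarith
  refine ⟨?_, ?_⟩
  · rintro ⟨F, hF1, hF2, hF3⟩
    obtain ⟨H, hH, hFH⟩ := JudgementAggregation.exists_isIndependent_dist_le A F hF1
    exact key F H hH hFH hF2 hF3
  · rintro ⟨F, ⟨H, hH, hFH⟩, ⟨K, hK, hFK⟩, hF3⟩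
    refine key F H hH (hFH.trans (by nlinarith [hδ.1])) ?_ hF3
    refine (JudgementAggregation.inconsistencyIndex_le_add_dist A K F).trans ?_
    rw [JudgementAggregation.dist_comm A K F, JudgementAggregation.inconsistencyIndex,
      JudgementAggregation.uniformProb_false fun X hX h => h (hK X hX), zero_add]
    exact hFK
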